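/- Let $G$ be a finite simple graph on $n$ vertices and let $k$ be a natural number. A proper coloring $\varphi\colon V(G)\to\{1,\dots,k\}$ is *equitable* if $\lfloor n/k\rfloor\le|\varphi^{-1}(i)|\le\lceil n/k\rceil$ for every color $i$. The problem Equitable Coloring asks, given $(G,k)$, whether $G$ has an equitable proper $k$-coloring. A *cluster graph* is a graph each of whose connected components is a clique, a *co-cluster graph* is the complement of a cluster graph, and the *distance to co-cluster* $\mathrm{dcc}(G)$ is the smallest size of a set $U\subseteq V(G)$ such that $G-U$ is a co-cluster graph. **Theorem.** Equitable Coloring is fixed-parameter tractable when parameterized by distance to co-cluster: there are a computable function $f\colon\mathbb N\to\mathbb N$, a constant $c$ and an algorithm (a program of a uniform-cost random access machine with addition, truncated subtraction and indirect addressing) that, given $(G,k)$ encoded by $n$, $k$ and the adjacency matrix of $G$, correctly decides whether $G$ has an equitable proper $k$-coloring in at most $f(\mathrm{dcc}(G))\cdot|(G,k)|^{c}$ steps, where $|(G,k)|$ is the binary length of the input. Neither a modulator $U$ nor the value $\mathrm{dcc}(G)$ is part of the input. -/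

import Mathlib

/-! ## Random access machines

Programs act on natural-number scalars `x₀, x₁, …` and natural-number arrays `A₀, A₁, …`;
a fixed program mentions only finitely many of them. The arithmetic operations are addition and
truncated subtraction (no multiplication), every elementary operation costs one step, and
indirect addressing is allowed: the uniform-cost RAM, with structured control flow. -/

namespace RAM

/-- Contents of the scalar variables and of the arrays. -/
structure State where
  var : ℕ → ℕ
  arr : ℕ → ℕ → ℕ

/-- Expressions. -/
inductive Expr where
  /-- a constant -/
  | const (c : ℕ)
  /-- the value of the scalar `x` -/
  | var (x : ℕ)
  /-- the entry of the array `a` at the index given by `i` -/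
  | read (a : ℕ) (i : Expr)
  /-- sum -/
  | add (e₁ e₂ : Expr)
  /-- difference, cut off at `0` -/
  | sub (e₁ e₂ : Expr)

/-- Value of an expression. -/
def Expr.eval (s : State) : Expr → ℕ
  | .const c => c
  | .var x => s.var x
  | .read a i => s.arr a (i.eval s)
  | .add e₁ e₂ => e₁.eval s + e₂.eval s
  | .sub e₁ e₂ => e₁.eval s - e₂.eval s

/-- Number of steps needed to evaluate an expression: one for each node. -/
def Expr.cost : Expr → ℕ
  | .const _ => 1
  | .var _ => 1
  | .read _ i => i.cost + 1
  | .add e₁ e₂ => e₁.cost + e₂.cost + 1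
  | .sub e₁ e₂ => e₁.cost + e₂.cost + 1

/-- Programs. -/
inductive Prog where
  /-- do nothing -/
  | skip
  /-- `x := e` -/
  | assign (x : ℕ) (e : Expr)
  /-- `a[i] := e` -/
  | write (a : ℕ) (i e : Expr)
  /-- first `p`, then `q` -/
  | seq (p q : Prog)
  /-- `p` if `e ≠ 0`, and `q` otherwise -/
  | branch (e : Expr) (p q : Prog)
  /-- repeat `p` as long as `e ≠ 0` -/
  | loop (e : Expr) (p : Prog)

/-- The state after `x := v`. -/
def State.setVar (s : State) (x v : ℕ) : State :=
  { s with var := Function.update s.var x v }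

/-- The state after `a[i] := v`. -/
def State.setArr (s : State) (a i v : ℕ) : State :=
  { s with arr := Function.update s.arr a (Function.update (s.arr a) i v) }

/-- `Exec p s t s'`: started in the state `s`, the program `p` halts after exactly `t` steps in
the state `s'`. -/
inductive Exec : Prog → State → ℕ → State → Prop where
  | skip (s : State) : Exec .skip s 1 s
  | assign (s : State) (x : ℕ) (e : Expr) :
      Exec (.assign x e) s (e.cost + 1) (s.setVar x (e.eval s))
  | write (s : State) (a : ℕ) (i e : Expr) :
      Exec (.write a i e) s (i.cost + e.cost + 1) (s.setArr a (i.eval s) (e.eval s))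
  | seq {p q : Prog} {s₁ s₂ s₃ : State} {t₁ t₂ : ℕ} :
      Exec p s₁ t₁ s₂ → Exec q s₂ t₂ s₃ → Exec (.seq p q) s₁ (t₁ + t₂) s₃
  | branch_true {e : Expr} {p q : Prog} {s s' : State} {t : ℕ} :
      e.eval s ≠ 0 → Exec p s t s' → Exec (.branch e p q) s (e.cost + 1 + t) s'
  | branch_false {e : Expr} {p q : Prog} {s s' : State} {t : ℕ} :
      e.eval s = 0 → Exec q s t s' → Exec (.branch e p q) s (e.cost + 1 + t) s'
  | loop_false {e : Expr} {p : Prog} {s : State} :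
      e.eval s = 0 → Exec (.loop e p) s (e.cost + 1) s
  | loop_true {e : Expr} {p : Prog} {s₁ s₂ s₃ : State} {t₁ t₂ : ℕ} :
      e.eval s₁ ≠ 0 → Exec p s₁ t₁ s₂ → Exec (.loop e p) s₂ t₂ s₃ →
      Exec (.loop e p) s₁ (e.cost + 1 + t₁ + t₂) s₃

/-- The initial state on the input `w`: the array `A₀` holds `w`, the scalar `x₀` holds the
length of `w`, and everything else is `0`. -/
def init (w : List ℕ) : State where
  var := fun x => if x = 0 then w.length else 0
  arr := fun a i => if a = 0 then w.getD i 0 else 0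

/-- Size of an input word: its total length in binary, with one separator for each number. -/
def inputSize (w : List ℕ) : ℕ := (w.map fun a => Nat.size a + 1).sum

end RAM

/-! ## Fixed-parameter tractability -/

/-- A parameterized decision problem: instances, their encoding as an input word, the
yes-instances, and the parameter of an instance. -/
structure ParamProblem where
  Inst : Type
  encode : Inst → List ℕ
  Yes : Inst → Prop
  param : Inst → ℕ

/-- One program halts on every instance `x`, with output `1` in `x₀` if `x` is a yes-instance and
output `0` otherwise, within `f (param x) * |x| ^ c` steps, where `f` is a computable function and
`c` a constant. The program sees only the encoding of `x`, not the parameter. -/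
def ParamProblem.IsFPT (P : ParamProblem) : Prop :=
  ∃ (p : RAM.Prog) (f : ℕ → ℕ) (c : ℕ), Computable f ∧
    ∀ x : P.Inst, ∃ (t : ℕ) (s : RAM.State),
      RAM.Exec p (RAM.init (P.encode x)) t s ∧
      t ≤ f (P.param x) * RAM.inputSize (P.encode x) ^ c ∧
      (P.Yes x → s.var 0 = 1) ∧ (¬ P.Yes x → s.var 0 = 0)

/-! ## Equitable coloring and distance to co-cluster -/

namespace SimpleGraph

/-- `G` has a proper `k`-coloring whose color classes all have size between `⌊n/k⌋` and `⌈n/k⌉`,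
where `n` is the number of vertices. -/
def EquitablyColorable {V : Type*} [Fintype V] (G : SimpleGraph V) (k : ℕ) : Prop :=
  ∃ φ : G.Coloring (Fin k), ∀ i : Fin k,
    Fintype.card V / k ≤ (φ.colorClass i).ncard ∧
    (φ.colorClass i).ncard ≤ Fintype.card V ⌈/⌉ k

/-- Each connected component is a clique. -/
def IsCluster {V : Type*} (G : SimpleGraph V) : Prop :=
  ∀ C : G.ConnectedComponent, G.IsClique C.supp

/-- Complement of a cluster graph. -/
def IsCoCluster {V : Type*} (G : SimpleGraph V) : Prop :=
  Gᶜ.IsCluster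

/-- The smallest size of a set `U` of vertices such that `G - U` is a co-cluster graph. -/
noncomputable def distToCoCluster {V : Type*} [Fintype V] (G : SimpleGraph V) : ℕ :=
  sInf {m | ∃ U : Finset V, U.card = m ∧ (G.induce {v | v ∉ U}).IsCoCluster}

end SimpleGraph

/-- An instance of Equitable Coloring: a finite graph, on the vertices `0, …, n - 1`, and the
number `k` of colors. -/
structure EqColInstance where
  n : ℕ
  G : SimpleGraph (Fin n)
  k : ℕ

open Classical in
/-- The input word `n, k` followed by the `n²` entries of the adjacency matrix, row by row. -/
noncomputable def EqColInstance.encode (x : EqColInstance) : List ℕ :=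
  x.n :: x.k ::
    List.ofFn fun t : Fin (x.n * x.n) => if x.G.Adj t.divNat t.modNat then 1 else 0

/-- Equitable Coloring parameterized by distance to co-cluster. -/
noncomputable def equitableColoringByDistToCoCluster : ParamProblem where
  Inst := EqColInstance
  encode := EqColInstance.encode
  Yes := fun x => x.G.EquitablyColorable x.k
  param := fun x => x.G.distToCoCluster

/-!
Repeatedly collecting the vertices of an obstruction (an edge `ab` and a vertex `c` adjacent to
neither end) that avoids the vertices collected so far yields a modulator `U`: every set whose
deletion leaves a co-cluster graph contains one of the at most three vertices collected in each
round, hence `#U ≤ 3 dcc(G)`. The graph `G - U` is complete multipartite, so each color occurring in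
it lives in a single part.

At most `p = min #U k` colors occur in `U`, without loss of generality the first ones, so the
coloring of `U` and the set of those of the first `p` colors that have the larger class size can be
guessed. The other colors are interchangeable: only their number in each part matters. Given the
set `S` of those among the first `p` colors that live in a part and the number `r` of others, the
part can be colored if and only if Hall's condition holds for all `T ⊆ S` and the size of the part
fits `r`. A dynamic program over the parts, with a table indexed by subsets of the first `p` colors
and numbers of others, distributes the colors.

Running times are controlled by closure properties of the functions computable in fixed-parameter
time from the registers holding the values of the variables in scope; the loops over subsets of `U`
and of colors are short because `#U` is bounded in the parameter.
-/

/-! ### Fixed-parameter computable functions -/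

namespace ParamProblem

variable {P : ParamProblem} {T T' : P.Inst → ℕ}

/-- `T` is at most a computable function of the parameter times a polynomial in the input size.
The summand `1` makes the polynomial monotone in its degree. -/
def FPTBounded (P : ParamProblem) (T : P.Inst → ℕ) : Prop :=
  ∃ (f : ℕ → ℕ) (c : ℕ), Computable f ∧
    ∀ x, T x ≤ f (P.param x) * (RAM.inputSize (P.encode x) + 1) ^ c

namespace FPTBounded

theorem mono (h : P.FPTBounded T) (hT : ∀ x, T' x ≤ T x) : P.FPTBounded T' := by
  obtain ⟨f, c, hf, hb⟩ := h
  exact ⟨f, c, hf, fun x => (hT x).trans (hb x)⟩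

theorem of_param {f : ℕ → ℕ} (hf : Computable f) (hT : ∀ x, T x ≤ f (P.param x)) :
    P.FPTBounded T :=
  ⟨f, 0, hf, fun x => by simpa using hT x⟩

theorem const (m : ℕ) : P.FPTBounded fun _ => m :=
  of_param (Computable.const m) fun _ => le_rfl

theorem of_inputSize (hT : ∀ x, T x ≤ RAM.inputSize (P.encode x)) : P.FPTBounded T :=
  ⟨fun _ => 1, 1, Computable.const 1, fun x => by simpa using (hT x).trans (Nat.le_succ _)⟩

theorem mul (h : P.FPTBounded T) (h' : P.FPTBounded T') : P.FPTBounded fun x => T x * T' x := by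
  obtain ⟨f, c, hf, hb⟩ := h
  obtain ⟨f', c', hf', hb'⟩ := h'
  refine ⟨fun d => f d * f' d, c + c', Computable₂.comp Primrec.nat_mul.to_comp hf hf', fun x => ?_⟩
  calc T x * T' x ≤ _ := Nat.mul_le_mul (hb x) (hb' x)
    _ = _ := by ring

theorem add (h : P.FPTBounded T) (h' : P.FPTBounded T') : P.FPTBounded fun x => T x + T' x := by
  obtain ⟨f, c, hf, hb⟩ := h
  obtain ⟨f', c', hf', hb'⟩ := h'
  refine ⟨fun d => f d + f' d, c + c', Computable₂.comp Primrec.nat_add.to_comp hf hf', fun x => ?_⟩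
  have hpos := Nat.succ_pos (RAM.inputSize (P.encode x))
  rw [add_mul]
  refine Nat.add_le_add ((hb x).trans ?_) ((hb' x).trans ?_)
  · exact Nat.mul_le_mul_left _ (Nat.pow_le_pow_right hpos (Nat.le_add_right c c'))
  · exact Nat.mul_le_mul_left _ (Nat.pow_le_pow_right hpos (Nat.le_add_left c' c))

end FPTBounded

end ParamProblem

namespace RAM

/-- Total correctness with a time bound: started in `s`, the program `p` halts within `T` steps in
a state satisfying the postcondition `Q`. -/
def Prog.Runs (p : Prog) (T : ℕ) (s : State) (Q : State → Prop) : Prop :=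
  ∃ (t : ℕ) (s' : State), Exec p s t s' ∧ t ≤ T ∧ Q s'

namespace Prog.Runs

variable {p q : Prog} {e : Expr} {T T' : ℕ} {s : State} {Q R : State → Prop}

theorem mono (h : p.Runs T s Q) (hT : T ≤ T') (hQ : ∀ s', Q s' → R s') : p.Runs T' s R := by
  obtain ⟨t, s', hE, ht, hs'⟩ := h
  exact ⟨t, s', hE, ht.trans hT, hQ s' hs'⟩

theorem assign {x : ℕ} (h : Q (s.setVar x (e.eval s))) : (assign x e).Runs (e.cost + 1) s Q :=
  ⟨_, _, .assign s x e, le_rfl, h⟩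

theorem seq (hp : p.Runs T s Q) (hq : ∀ s', Q s' → q.Runs T' s' R) :
    (seq p q).Runs (T + T') s R := by
  obtain ⟨t, s', hE, ht, hs'⟩ := hp
  obtain ⟨t', s'', hE', ht', hs''⟩ := hq s' hs'
  exact ⟨_, s'', .seq hE hE', Nat.add_le_add ht ht', hs''⟩

theorem branch (hp : e.eval s ≠ 0 → p.Runs T s Q) (hq : e.eval s = 0 → q.Runs T' s Q) :
    (branch e p q).Runs (e.cost + 1 + (T + T')) s Q := by
  by_cases he : e.eval s = 0
  · obtain ⟨t, s', hE, ht, hs'⟩ := hq he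
    exact ⟨_, s', .branch_false he hE, by lia, hs'⟩
  · obtain ⟨t, s', hE, ht, hs'⟩ := hp he
    exact ⟨_, s', .branch_true he hE, by lia, hs'⟩

theorem loop {N : ℕ} (Inv : ℕ → State → Prop)
    (hcond : ∀ i s, Inv i s → (e.eval s ≠ 0 ↔ i < N))
    (hbody : ∀ i s, i < N → Inv i s → p.Runs T s (Inv (i + 1))) {s : State} (h0 : Inv 0 s) :
    (loop e p).Runs ((N + 1) * (e.cost + 1 + T)) s (Inv N) := by
  suffices h : ∀ r i s, r + i = N → Inv i s →
      (Prog.loop e p).Runs ((r + 1) * (e.cost + 1 + T)) s (Inv N) from h N 0 s rfl h0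
  intro r
  induction r with
  | zero =>
    intro i s hi hs
    obtain rfl : i = N := by lia
    exact ⟨_, s, .loop_false (by simpa using hcond i s hs), by lia, hs⟩
  | succ r ih =>
    intro i s hi hs
    obtain ⟨t, s₁, hE, ht, hs₁⟩ := hbody i s (by lia) hs
    obtain ⟨t', s₂, hE', ht', hs₂⟩ := ih (i + 1) s₁ (by lia) hs₁
    exact ⟨_, s₂, .loop_true ((hcond i s hs).2 (by lia)) hE hE', by lia, hs₂⟩

end Prog.Runs

/-- The registers below `b` and the arrays have the same contents in both states. -/
def State.AgreeBelow (b : ℕ) (s s' : State) : Prop :=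
  (∀ x < b, s'.var x = s.var x) ∧ s'.arr = s.arr

namespace State.AgreeBelow

variable {b b' x v : ℕ} {s s' s'' : State}

theorem refl (b : ℕ) (s : State) : s.AgreeBelow b s := ⟨fun _ _ => rfl, rfl⟩

theorem trans (h : AgreeBelow b s s') (h' : AgreeBelow b s' s'') : AgreeBelow b s s'' :=
  ⟨fun x hx => (h'.1 x hx).trans (h.1 x hx), h'.2.trans h.2⟩

theorem mono (h : AgreeBelow b' s s') (hb : b ≤ b') : AgreeBelow b s s' :=
  ⟨fun x hx => h.1 x (hx.trans_le hb), h.2⟩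

theorem setVar (h : AgreeBelow b s s') (hx : b ≤ x) : AgreeBelow b s (s'.setVar x v) :=
  ⟨fun y hy => by simp [State.setVar, (hy.trans_le hx).ne, h.1 y hy], h.2⟩

end State.AgreeBelow

@[simp] theorem State.setVar_self (s : State) (x v : ℕ) : (s.setVar x v).var x = v := by
  simp [State.setVar]

/-- Finitely many natural-number variables and an instance of `P`, all depending on a parameter
of type `α`: what a program fragment can refer to. -/
structure Context (P : ParamProblem) (α : Type) where
  arity : ℕ
  val : α → ℕ → ℕ
  inst : α → P.Inst

namespace Context

variable {P : ParamProblem} {α : Type}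

/-- The context with one more variable. -/
def ext (Γ : Context P α) : Context P (α × ℕ) where
  arity := Γ.arity + 1
  val := fun a x => if x = Γ.arity then a.2 else Γ.val a.1 x
  inst := fun a => Γ.inst a.1

/-- The context without variables. -/
def base (P : ParamProblem) : Context P P.Inst where
  arity := 0
  val := fun _ _ => 0
  inst := id

/-- In the state `s` the array `A₀` holds the instance and the registers `σ 0, σ 1, …` hold the
variables of the context. -/
def Holds (Γ : Context P α) (σ : ℕ → ℕ) (a : α) (s : State) : Prop :=
  (∀ x < Γ.arity, s.var (σ x) = Γ.val a x) ∧
    s.arr 0 = fun i => (P.encode (Γ.inst a)).getD i 0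

variable {Γ : Context P α} {σ : ℕ → ℕ} {a : α} {b : ℕ} {s s' : State}

theorem Holds.of_agreeBelow (h : Γ.Holds σ a s) (hσ : ∀ x < Γ.arity, σ x < b)
    (hs : s.AgreeBelow b s') : Γ.Holds σ a s' :=
  ⟨fun x hx => (hs.1 _ (hσ x hx)).trans (h.1 x hx), hs.2 ▸ h.2⟩

theorem Holds.ext {y v : ℕ} (h : Γ.Holds σ a s) (hy : s.var y = v) :
    Γ.ext.Holds (fun x => if x = Γ.arity then y else σ x) (a, v) s := by
  refine ⟨fun x hx => ?_, h.2⟩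
  obtain hx | rfl := Nat.lt_succ_iff_lt_or_eq.1 hx
  · simpa [Context.ext, hx.ne] using h.1 x hx
  · simpa [Context.ext] using hy

end Context

open ParamProblem

variable {P : ParamProblem} {α β : Type} {Γ : Context P α} {Δ : Context P β} {f : α → β}
  {F G : α → ℕ} {B : P.Inst → ℕ}

/-- The postcondition of a program fragment that computes `v` into the register `b`, using only
registers from `b` on. -/
def State.Yields (s : State) (b v : ℕ) (s' : State) : Prop :=
  s'.var b = v ∧ s.AgreeBelow b s'

/-- `F` can be computed in fixed-parameter time from the variables of the context and the
instance, wherever below a register `b` these variables are placed. -/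
def FPTComputable (Γ : Context P α) (F : α → ℕ) : Prop :=
  ∃ T : P.Inst → ℕ, P.FPTBounded T ∧
    ∀ (σ : ℕ → ℕ) (b : ℕ), (∀ x < Γ.arity, σ x < b) →
      ∃ p : Prog, ∀ a s, Γ.Holds σ a s → p.Runs (T (Γ.inst a)) s (s.Yields b (F a))

/-- `p` can be decided in fixed-parameter time: nonzero values stand for truth, as in the control
structures of the machine. -/
def FPTDecidable (Γ : Context P α) (p : α → Prop) : Prop :=
  ∃ F : α → ℕ, FPTComputable Γ F ∧ ∀ a, p a ↔ F a ≠ 0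

/-- `B` can serve as the number of iterations of a loop. -/
structure IsLoopBound (B : P.Inst → ℕ) : Prop where
  bounded : P.FPTBounded B
  computable_base : FPTComputable (Context.base P) B

namespace FPTComputable

theorem congr (h : FPTComputable Γ F) (hFG : ∀ a, F a = G a) : FPTComputable Γ G :=
  (funext hFG : F = G) ▸ h

theorem const (Γ : Context P α) (m : ℕ) : FPTComputable Γ fun _ => m :=
  ⟨fun _ => 2, .const 2, fun _ b _ => ⟨.assign b (.const m), fun _ _ _ =>
    .assign ⟨by simp [Expr.eval], (State.AgreeBelow.refl b _).setVar le_rfl⟩⟩⟩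

theorem var {x : ℕ} (hx : x < Γ.arity) : FPTComputable Γ fun a => Γ.val a x :=
  ⟨fun _ => 2, .const 2, fun σ b _ => ⟨.assign b (.var (σ x)), fun _ s hs =>
    .assign ⟨by simpa [Expr.eval] using hs.1 x hx, (State.AgreeBelow.refl b s).setVar le_rfl⟩⟩⟩

theorem last (Γ : Context P α) : FPTComputable Γ.ext fun a => a.2 :=
  (var (Nat.lt_succ_self Γ.arity)).congr fun _ => if_pos rfl

end FPTComputable

/-- A substitution: each variable of `Δ` and its instance are given by `f` in terms of the
variables of `Γ` and its instance, the former in fixed-parameter time, the latter unchanged. -/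
structure FPTMap (Γ : Context P α) (Δ : Context P β) (f : α → β) : Prop where
  inst (a : α) : Δ.inst (f a) = Γ.inst a
  val (x : ℕ) (hx : x < Δ.arity) : FPTComputable Γ fun a => Δ.val (f a) x

theorem FPTMap.exists_runs (hf : FPTMap Γ Δ f) (m : ℕ) (hm : m ≤ Δ.arity) :
    ∃ T : P.Inst → ℕ, P.FPTBounded T ∧ ∀ (σ : ℕ → ℕ) (b : ℕ), (∀ x < Γ.arity, σ x < b) →
      ∃ p : Prog, ∀ a s, Γ.Holds σ a s → p.Runs (T (Γ.inst a)) s fun s' =>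
        (∀ x < m, s'.var (b + x) = Δ.val (f a) x) ∧ s.AgreeBelow b s' := by
  induction m with
  | zero =>
    exact ⟨fun _ => 2, .const 2, fun σ b _ => ⟨.assign b (.const 0), fun _ s _ =>
      .assign ⟨fun x hx => absurd hx x.not_lt_zero, (State.AgreeBelow.refl b s).setVar le_rfl⟩⟩⟩
  | succ m ih =>
    obtain ⟨T, hT, h⟩ := ih (Nat.le_of_succ_le hm)
    obtain ⟨T', hT', h'⟩ := hf.val m hm
    refine ⟨_, hT.add hT', fun σ b hσ => ?_⟩
    obtain ⟨p, hp⟩ := h σ b hσ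
    obtain ⟨q, hq⟩ := h' σ (b + m) fun x hx => (hσ x hx).trans_le (Nat.le_add_right b m)
    refine ⟨.seq p q, fun a s hs => (hp a s hs).seq fun s₁ h₁ => ?_⟩
    refine (hq a s₁ (hs.of_agreeBelow hσ h₁.2)).mono le_rfl fun s₂ h₂ =>
      ⟨fun x hx => ?_, h₁.2.trans (h₂.2.mono (Nat.le_add_right b m))⟩
    obtain hx | rfl := Nat.lt_succ_iff_lt_or_eq.1 hx
    exacts [(h₂.2.1 _ (Nat.add_lt_add_left hx b)).trans (h₁.1 x hx), h₂.1]

namespace FPTComputable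

theorem comp {F : β → ℕ} (hF : FPTComputable Δ F) (hf : FPTMap Γ Δ f) :
    FPTComputable Γ fun a => F (f a) := by
  obtain ⟨T, hT, h⟩ := hf.exists_runs Δ.arity le_rfl
  obtain ⟨T', hT', hF⟩ := hF
  refine ⟨_, hT.add (hT'.add (.const 2)), fun σ b hσ => ?_⟩
  obtain ⟨p, hp⟩ := h σ b hσ
  obtain ⟨q, hq⟩ := hF (b + ·) (b + Δ.arity) fun x hx => Nat.add_lt_add_left hx b
  refine ⟨.seq p (.seq q (.assign b (.var (b + Δ.arity)))), fun a s hs => ?_⟩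
  refine (hp a s hs).seq fun s₁ h₁ => ?_
  have hs₁ : Δ.Holds (b + ·) (f a) s₁ := ⟨h₁.1, by rw [hf.inst, h₁.2.2, hs.2]⟩
  exact hf.inst a ▸ (hq (f a) s₁ hs₁).seq fun s₂ h₂ => .assign
    ⟨by simpa [Expr.eval] using h₂.1,
      (h₁.2.trans (h₂.2.mono (Nat.le_add_right b _))).setVar le_rfl⟩

end FPTComputable

namespace FPTMap

theorem id (Γ : Context P α) : FPTMap Γ Γ fun a => a :=
  ⟨fun _ => rfl, fun _ hx => .var hx⟩

theorem wk (hf : FPTMap Γ Δ f) : FPTMap Γ.ext Δ fun a => f a.1 :=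
  have hfst : FPTMap Γ.ext Γ Prod.fst := ⟨fun _ => rfl, fun _ hx =>
    (FPTComputable.var (Nat.lt_succ_of_lt hx)).congr fun _ => if_neg hx.ne⟩
  ⟨fun a => hf.inst a.1, fun x hx => (hf.val x hx).comp hfst⟩

theorem ext (hf : FPTMap Γ Δ f) (hF : FPTComputable Γ F) :
    FPTMap Γ Δ.ext fun a => (f a, F a) := by
  refine ⟨hf.inst, fun x hx => ?_⟩
  obtain hx | rfl := Nat.lt_succ_iff_lt_or_eq.1 hx
  exacts [(hf.val x hx).congr fun _ => (if_neg hx.ne).symm, hF.congr fun _ => (if_pos rfl).symm]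

end FPTMap

namespace FPTComputable

theorem wk (hF : FPTComputable Γ F) : FPTComputable Γ.ext fun a => F a.1 :=
  hF.comp (.wk (.id Γ))

theorem of_base (h : FPTComputable (Context.base P) B) (Γ : Context P α) :
    FPTComputable Γ fun a => B (Γ.inst a) :=
  h.comp ⟨fun _ => rfl, fun _ hx => absurd hx (Nat.not_lt_zero _)⟩

theorem read (h : FPTComputable Γ F) :
    FPTComputable Γ fun a => (P.encode (Γ.inst a)).getD (F a) 0 := by
  obtain ⟨T, hT, h⟩ := h
  refine ⟨_, hT.add (.const 3), fun σ b hσ => ?_⟩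
  obtain ⟨p, hp⟩ := h σ b hσ
  refine ⟨.seq p (.assign b (.read 0 (.var b))), fun a s hs => (hp a s hs).seq ?_⟩
  refine fun s' hs' => .assign ⟨?_, hs'.2.setVar le_rfl⟩
  simp [Expr.eval, hs'.1, (hs.of_agreeBelow hσ hs'.2).2]

theorem binary (hF : FPTComputable Γ F) (hG : FPTComputable Γ G)
    {op : ℕ → ℕ → ℕ} {e : Expr → Expr → Expr}
    (he : ∀ s e₁ e₂, (e e₁ e₂).eval s = op (e₁.eval s) (e₂.eval s))
    (hc : ∀ e₁ e₂, (e e₁ e₂).cost = e₁.cost + e₂.cost + 1) :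
    FPTComputable Γ fun a => op (F a) (G a) := by
  obtain ⟨T, hT, hF⟩ := hF
  obtain ⟨T', hT', hG⟩ := hG
  refine ⟨_, hT.add (hT'.add (.const 4)), fun σ b hσ => ?_⟩
  obtain ⟨p, hp⟩ := hF σ b hσ
  obtain ⟨q, hq⟩ := hG σ (b + 1) fun x hx => (hσ x hx).trans (Nat.lt_succ_self b)
  refine ⟨.seq p (.seq q (.assign b (e (.var b) (.var (b + 1))))), fun a s hs => ?_⟩
  refine (hp a s hs).seq fun s₁ h₁ => ?_
  refine (hq a s₁ (hs.of_agreeBelow hσ h₁.2)).seq fun s₂ h₂ => ?_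
  refine (Prog.Runs.assign ⟨?_, (h₁.2.trans (h₂.2.mono b.le_succ)).setVar le_rfl⟩).mono
    (hc _ _ ▸ le_rfl) fun _ => id
  rw [State.setVar_self, he]
  simp [Expr.eval, h₂.1, h₂.2.1 b b.lt_succ_self, h₁.1]

theorem add (hF : FPTComputable Γ F) (hG : FPTComputable Γ G) :
    FPTComputable Γ fun a => F a + G a :=
  hF.binary hG (e := .add) (fun _ _ _ => rfl) fun _ _ => rfl

theorem sub (hF : FPTComputable Γ F) (hG : FPTComputable Γ G) :
    FPTComputable Γ fun a => F a - G a :=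
  hF.binary hG (e := .sub) (fun _ _ _ => rfl) fun _ _ => rfl

theorem ite {p : α → Prop} [DecidablePred p] (hp : FPTDecidable Γ p) (hF : FPTComputable Γ F)
    (hG : FPTComputable Γ G) : FPTComputable Γ fun a => if p a then F a else G a := by
  obtain ⟨C, ⟨T, hT, hC⟩, hpC⟩ := hp
  obtain ⟨T', hT', hF⟩ := hF
  obtain ⟨T'', hT'', hG⟩ := hG
  refine ⟨_, hT.add (.add (.const 2) (hT'.add hT'')), fun σ b hσ => ?_⟩
  obtain ⟨pC, hpC'⟩ := hC σ b hσ
  obtain ⟨pF, hpF⟩ := hF σ b hσ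
  obtain ⟨pG, hpG⟩ := hG σ b hσ
  refine ⟨.seq pC (.branch (.var b) pF pG), fun a s hs => (hpC' a s hs).seq fun s₁ h₁ => ?_⟩
  have hs₁ := hs.of_agreeBelow hσ h₁.2
  have heval : (Expr.var b).eval s₁ ≠ 0 ↔ p a := by rw [hpC, ← h₁.1]; rfl
  refine .branch (fun h => ?_) fun h => ?_
  · exact (hpF a s₁ hs₁).mono le_rfl fun _ h₂ =>
      ⟨h₂.1.trans (if_pos (heval.1 h)).symm, h₁.2.trans h₂.2⟩
  · exact (hpG a s₁ hs₁).mono le_rfl fun _ h₂ =>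
      ⟨h₂.1.trans (if_neg fun hpa => heval.2 hpa h).symm, h₁.2.trans h₂.2⟩

/-- The state of the loop implementing a bounded iteration after `i` rounds: the register `b`
holds the number of rounds, `b + 1` the accumulator and `b + 2` the counter. -/
def FoldInv (N init : ℕ) (step : ℕ → ℕ → ℕ) (b : ℕ) (s : State) (i : ℕ) (s' : State) : Prop :=
  s'.var b = N ∧ s'.var (b + 1) = (List.range i).foldl step init ∧ s'.var (b + 2) = i ∧
    s.AgreeBelow b s'

/-- The loop body of a bounded iteration, where `p` computes the new accumulator into `b + 3`. -/
def foldBody (p : Prog) (b : ℕ) : Prog :=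
  .seq p (.seq (.assign (b + 1) (.var (b + 3))) (.assign (b + 2) (.add (.var (b + 2)) (.const 1))))

theorem runs_foldBody {p : Prog} {N init b i T : ℕ} {step : ℕ → ℕ → ℕ} {s s' : State}
    (h : FoldInv N init step b s i s')
    (hp : p.Runs T s' (s'.Yields (b + 3) (step ((List.range i).foldl step init) i))) :
    (foldBody p b).Runs (T + (2 + 4)) s' (FoldInv N init step b s (i + 1)) := by
  obtain ⟨hb, -, hi, hs⟩ := h
  refine hp.seq fun s₁ h₁ => .seq (.assign (Q := (· = _)) rfl) ?_
  rintro _ rfl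
  refine .assign ⟨?_, ?_, ?_, ((hs.trans (h₁.2.mono (by lia))).setVar (by lia)).setVar (by lia)⟩
  · simp [State.setVar, h₁.2.1, hb]
  · simp [State.setVar, Expr.eval, h₁.1, List.range_succ]
  · simp [State.setVar, Expr.eval, h₁.2.1, hi]

theorem foldl {step : α → ℕ → ℕ → ℕ} (hB : IsLoopBound B) (hF : FPTComputable Γ F)
    (hstep : FPTComputable Γ.ext.ext fun a => step a.1.1 a.2 a.1.2) :
    FPTComputable Γ fun a => (List.range (B (Γ.inst a))).foldl (step a) (F a) := by
  obtain ⟨TB, hTB, hpB⟩ := hB.computable_base.of_base Γ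
  obtain ⟨TF, hTF, hpF⟩ := hF
  obtain ⟨TG, hTG, hpG⟩ := hstep
  refine ⟨_, hTB.add (hTF.add (.add (.const 2)
    (.add (.mul (hB.bounded.add (.const 1)) (.add (.const 4) (hTG.add (.const 6)))) (.const 2)))),
    fun σ b hσ => ?_⟩
  obtain ⟨pB, hpB⟩ := hpB σ b hσ
  obtain ⟨pF, hpF⟩ := hpF σ (b + 1) fun x hx => (hσ x hx).trans b.lt_succ_self
  obtain ⟨pG, hpG⟩ := hpG (fun x => if x = Γ.arity + 1 then b + 1 else
      if x = Γ.arity then b + 2 else σ x) (b + 3) fun x hx => by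
    have hx : x < Γ.arity + 2 := hx
    split_ifs
    · lia
    · lia
    · exact (hσ x (by lia)).trans (by lia)
  refine ⟨.seq pB (.seq pF (.seq (.assign (b + 2) (.const 0)) (.seq
    (.loop (.sub (.var b) (.var (b + 2))) (foldBody pG b)) (.assign b (.var (b + 1)))))),
    fun a s hs => ?_⟩
  refine (hpB a s hs).seq fun s₁ h₁ => (hpF a s₁ (hs.of_agreeBelow hσ h₁.2)).seq fun s₂ h₂ => ?_
  have h₀ : FoldInv (B (Γ.inst a)) (F a) (step a) b s 0 (s₂.setVar (b + 2) 0) :=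
    ⟨by simp [State.setVar, h₂.2.1, h₁.1], by simp [State.setVar, h₂.1], by simp,
      (h₁.2.trans (h₂.2.mono b.le_succ)).setVar (by lia)⟩
  refine .seq (.assign h₀) fun s₃ h₃ =>
    .seq (.loop (FoldInv (B (Γ.inst a)) (F a) (step a) b s) ?_ ?_ h₃) fun s₄ h₄ =>
      .assign ⟨by simpa [Expr.eval] using h₄.2.1, h₄.2.2.2.setVar le_rfl⟩
  · intro i z hz
    simp only [Expr.eval, hz.1, hz.2.2.1]
    lia
  · intro i z _ hz
    exact runs_foldBody hz (hpG ((a, i), _) z (((hs.of_agreeBelow hσ hz.2.2.2).ext hz.2.2.1).ext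
      hz.2.1))

end FPTComputable

theorem isFPT_of_fptDecidable (hpos : ∀ x, 0 < inputSize (P.encode x))
    (h : FPTDecidable (Context.base P) P.Yes) : P.IsFPT := by
  classical
  obtain ⟨T, ⟨f, c, hf, hT⟩, h⟩ := FPTComputable.ite h (.const _ 1) (.const _ 0)
  obtain ⟨p, hp⟩ := h id 0 fun x hx => absurd hx (Nat.not_lt_zero x)
  refine ⟨p, fun d => f d * 2 ^ c, c, Computable₂.comp Primrec.nat_mul.to_comp hf (.const _),
    fun x => ?_⟩
  obtain ⟨t, s, hE, ht, hv, -⟩ := hp x (init (P.encode x))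
    ⟨fun x hx => absurd hx (Nat.not_lt_zero x), by ext i; simp [init, Context.base]⟩
  refine ⟨t, s, hE, ?_, fun h => hv.trans (if_pos h), fun h => hv.trans (if_neg h)⟩
  calc t ≤ T x := ht
    _ ≤ f (P.param x) * (inputSize (P.encode x) + 1) ^ c := hT x
    _ ≤ f (P.param x) * (2 * inputSize (P.encode x)) ^ c := by
      gcongr
      have := hpos x
      lia
    _ = _ := by rw [mul_pow, mul_assoc]

open Finset

variable {B' : P.Inst → ℕ} {p q : α → Prop}

namespace FPTDecidable

theorem congr (hp : FPTDecidable Γ p) (h : ∀ a, p a ↔ q a) : FPTDecidable Γ q :=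
  (funext fun a => propext (h a) : p = q) ▸ hp

theorem ne_zero (hF : FPTComputable Γ F) : FPTDecidable Γ fun a => F a ≠ 0 :=
  ⟨F, hF, fun _ => Iff.rfl⟩

theorem comp {p : β → Prop} (hp : FPTDecidable Δ p) (hf : FPTMap Γ Δ f) :
    FPTDecidable Γ fun a => p (f a) := by
  obtain ⟨F, hF, h⟩ := hp
  exact ⟨_, hF.comp hf, fun a => h (f a)⟩

theorem wk (hp : FPTDecidable Γ p) : FPTDecidable Γ.ext fun a => p a.1 :=
  hp.comp (.wk (.id Γ))

theorem and (hp : FPTDecidable Γ p) (hq : FPTDecidable Γ q) :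
    FPTDecidable Γ fun a => p a ∧ q a := by
  classical
  obtain ⟨F, hF, h⟩ := hq
  exact ⟨_, .ite hp hF (.const Γ 0), fun a => by by_cases hpa : p a <;> simp [hpa, h]⟩

theorem not (hp : FPTDecidable Γ p) : FPTDecidable Γ fun a => ¬ p a := by
  classical
  exact ⟨_, .ite hp (.const Γ 0) (.const Γ 1), fun a => by by_cases hpa : p a <;> simp [hpa]⟩

theorem or (hp : FPTDecidable Γ p) (hq : FPTDecidable Γ q) : FPTDecidable Γ fun a => p a ∨ q a :=
  (hp.not.and hq.not).not.congr fun _ => by tauto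

theorem imp (hp : FPTDecidable Γ p) (hq : FPTDecidable Γ q) : FPTDecidable Γ fun a => p a → q a :=
  (hp.and hq.not).not.congr fun _ => by tauto

theorem lt (hF : FPTComputable Γ F) (hG : FPTComputable Γ G) : FPTDecidable Γ fun a => F a < G a :=
  ⟨_, hG.sub hF, fun _ => Nat.sub_ne_zero_iff_lt.symm⟩

theorem le (hF : FPTComputable Γ F) (hG : FPTComputable Γ G) : FPTDecidable Γ fun a => F a ≤ G a :=
  (lt hG hF).not.congr fun _ => not_lt

theorem eq (hF : FPTComputable Γ F) (hG : FPTComputable Γ G) : FPTDecidable Γ fun a => F a = G a :=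
  ((le hF hG).and (le hG hF)).congr fun _ => le_antisymm_iff.symm

end FPTDecidable

namespace FPTComputable

theorem min (hF : FPTComputable Γ F) (hG : FPTComputable Γ G) :
    FPTComputable Γ fun a => min (F a) (G a) :=
  (ite (.le hF hG) hF hG).congr fun _ => (min_def _ _).symm

theorem sum {f : α → ℕ → ℕ} (hB : IsLoopBound B) (hf : FPTComputable Γ.ext fun a => f a.1 a.2) :
    FPTComputable Γ fun a => ∑ i ∈ range (B (Γ.inst a)), f a i := by
  refine (foldl (step := fun a acc i => acc + f a i) hB (.const Γ 0)
    ((last Γ.ext).add hf.wk)).congr fun a => ?_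
  induction B (Γ.inst a) with
  | zero => rfl
  | succ n ih => rw [List.range_succ, List.foldl_concat, ih, sum_range_succ]

theorem card_filter {p : α → ℕ → Prop} [∀ a, DecidablePred (p a)] (hB : IsLoopBound B)
    (hp : FPTDecidable Γ.ext fun a => p a.1 a.2) :
    FPTComputable Γ fun a => #{i ∈ range (B (Γ.inst a)) | p a i} :=
  (sum (f := fun a i => if p a i then 1 else 0) hB
    (ite (p := fun a : α × ℕ => p a.1 a.2) hp (.const _ 1) (.const _ 0))).congr
    fun _ => (Finset.card_filter _ _).symm

end FPTComputable

namespace IsLoopBound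

theorem computable (h : IsLoopBound B) (Γ : Context P α) : FPTComputable Γ fun a => B (Γ.inst a) :=
  h.computable_base.of_base Γ

theorem of_le (hB : IsLoopBound B) (hB' : FPTComputable (Context.base P) B')
    (hle : ∀ x, B' x ≤ B x) : IsLoopBound B' :=
  ⟨hB.bounded.mono hle, hB'⟩

theorem const (m : ℕ) : IsLoopBound fun _ : P.Inst => m :=
  ⟨.const m, .const _ m⟩

theorem add (h : IsLoopBound B) (h' : IsLoopBound B') : IsLoopBound fun x => B x + B' x :=
  ⟨h.bounded.add h'.bounded, h.computable_base.add h'.computable_base⟩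

theorem mul (h : IsLoopBound B) (h' : IsLoopBound B') : IsLoopBound fun x => B x * B' x :=
  ⟨h.bounded.mul h'.bounded, (FPTComputable.sum (f := fun x _ => B' x) h
    h'.computable_base.wk).congr fun x => by simp [Context.base]⟩

end IsLoopBound

namespace FPTComputable

theorem min_mul (hB : IsLoopBound B) (hF : FPTComputable Γ F) (hG : FPTComputable Γ G) :
    FPTComputable Γ fun a => Min.min (F a) (B (Γ.inst a)) * G a := by
  refine (sum (f := fun a i => if i < F a then G a else 0) hB
    (ite (p := fun a : α × ℕ => a.2 < F a.1) (.lt (last Γ) hF.wk) hG.wk (.const _ 0))).congr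
      fun a => ?_
  rw [← sum_filter, sum_const, smul_eq_mul]
  congr 1
  convert card_range _ using 2
  ext i
  simp [and_comm]

theorem mul_of_le (hB : IsLoopBound B) (hF : FPTComputable Γ F) (hG : FPTComputable Γ G)
    (hFB : ∀ a, F a ≤ B (Γ.inst a)) : FPTComputable Γ fun a => F a * G a :=
  (min_mul hB hF hG).congr fun a => by rw [min_eq_left (hFB a)]

theorem div_of_le (hB : IsLoopBound B) (hF : FPTComputable Γ F) (hG : FPTComputable Γ G)
    (hFB : ∀ a, F a ≤ B (Γ.inst a)) : FPTComputable Γ fun a => F a / G a := by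
  refine (card_filter (p := fun a i => 0 < G a ∧ (Min.min i (B (Γ.inst a)) + 1) * G a ≤ F a) hB
    (.and (.lt (.const _ 0) hG.wk) (.le ?_ hF.wk))).congr fun a => ?_
  · exact ((min_mul hB (last Γ) hG.wk).add hG.wk).congr fun a => by
      simp only [Nat.add_one_mul]; rfl
  · obtain h0 | h0 := Nat.eq_zero_or_pos (G a)
    · simp [h0]
    · convert card_range (F a / G a) using 2
      ext i
      have hdiv := (Nat.div_le_self (F a) (G a)).trans (hFB a)
      simp only [mem_filter, mem_range, h0, true_and]
      rw [← Nat.le_div_iff_mul_le h0]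
      lia

theorem two_pow_min (hB : IsLoopBound B) (hF : FPTComputable Γ F) :
    FPTComputable Γ fun a => 2 ^ Min.min (F a) (B (Γ.inst a)) := by
  refine (foldl (step := fun a acc i => if i < F a then acc + acc else acc) hB (.const Γ 1)
    (ite (p := fun a : (α × ℕ) × ℕ => a.1.2 < F a.1.1) (.lt (last Γ).wk hF.wk.wk)
      ((last _).add (last _)) (last _))).congr fun a => ?_
  induction B (Γ.inst a) with
  | zero => simp
  | succ n ih =>
    rw [List.range_succ, List.foldl_concat, ih]
    split_ifs with h
    · rw [min_eq_right h.le, min_eq_right h, ← two_mul, pow_succ']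
    · rw [min_eq_left (not_lt.1 h), min_eq_left (by lia)]

end FPTComputable

theorem IsLoopBound.two_pow (hB : IsLoopBound B) {f : ℕ → ℕ} (hf : Computable f)
    (hBf : ∀ x, B x ≤ f (P.param x)) : IsLoopBound fun x => 2 ^ B x := by
  refine ⟨.of_param (f := fun d => 2 ^ f d) ?_ fun x => Nat.pow_le_pow_right two_pos (hBf x), ?_⟩
  · exact Computable₂.comp (Primrec₂.unpaired'.1 Nat.Primrec.pow).to_comp (.const 2) hf
  · exact (FPTComputable.two_pow_min hB hB.computable_base).congr fun x => by simp [Context.base]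

/-- The finite sets of numbers below `B` are coded by the numbers below `2 ^ B`; numbers that are
too large code the empty set. -/
def decodeFinset (B m : ℕ) : Finset ℕ :=
  if m < 2 ^ B then equivBitIndices m else ∅

theorem mem_decodeFinset {B m i : ℕ} : i ∈ decodeFinset B m ↔ m < 2 ^ B ∧ m.testBit i := by
  unfold decodeFinset
  split_ifs with h <;> simp [h]

theorem decodeFinset_subset (B m : ℕ) : decodeFinset B m ⊆ range B := fun i hi => by
  obtain ⟨hm, hi⟩ := mem_decodeFinset.1 hi
  exact mem_range.2 ((Nat.pow_lt_pow_iff_right one_lt_two).1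
    ((Nat.ge_two_pow_of_testBit hi).trans_lt hm))

theorem sum_two_pow_lt {B : ℕ} {S : Finset ℕ} (hS : S ⊆ range B) : ∑ i ∈ S, 2 ^ i < 2 ^ B :=
  Nat.geomSum_lt le_rfl fun _ hi => mem_range.1 (hS hi)

theorem decodeFinset_sum_two_pow {B : ℕ} {S : Finset ℕ} (hS : S ⊆ range B) :
    decodeFinset B (∑ i ∈ S, 2 ^ i) = S := by
  rw [decodeFinset, if_pos (sum_two_pow_lt hS)]
  exact equivBitIndices.apply_symm_apply S

theorem two_pow_le_mod_iff_testBit (m i : ℕ) : 2 ^ i ≤ m % 2 ^ (i + 1) ↔ m.testBit i := by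
  have hlt := m.mod_lt (Nat.two_pow_pos i)
  rw [Nat.testBit_eq_decide_div_mod_eq, decide_eq_true_iff, pow_succ, Nat.mod_mul]
  obtain h | h := Nat.mod_two_eq_zero_or_one (m / 2 ^ i) <;> simp [h, hlt]

theorem mod_two_pow_succ_sub (m i : ℕ) :
    (if 2 ^ i ≤ m % 2 ^ (i + 1) then m % 2 ^ (i + 1) - 2 ^ i else m % 2 ^ (i + 1)) = m % 2 ^ i := by
  have hlt := m.mod_lt (Nat.two_pow_pos i)
  rw [pow_succ, Nat.mod_mul]
  obtain h | h := Nat.mod_two_eq_zero_or_one (m / 2 ^ i) <;> simp [h, hlt]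

theorem foldl_sub_two_pow {B m : ℕ} (hm : m < 2 ^ B) (i r : ℕ) (hr : r ≤ B) :
    (List.range r).foldl (fun acc j =>
      if i ≤ B - 1 - j ∧ 2 ^ (B - 1 - j) ≤ acc then acc - 2 ^ (B - 1 - j) else acc) m =
      m % 2 ^ max i (B - r) := by
  induction r with
  | zero =>
    exact (Nat.mod_eq_of_lt (hm.trans_le (Nat.pow_le_pow_right two_pos (le_max_right _ _)))).symm
  | succ r ih =>
    rw [List.range_succ, List.foldl_concat, ih (by lia)]
    by_cases hi : i ≤ B - 1 - r
    · rw [max_eq_right (by lia), max_eq_right (by lia), show B - r = B - 1 - r + 1 by lia,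
        show B - (r + 1) = B - 1 - r by lia]
      simpa only [hi, true_and] using mod_two_pow_succ_sub m (B - 1 - r)
    · rw [if_neg fun h => hi h.1, max_eq_left (by lia), max_eq_left (by lia)]

theorem FPTComputable.mod_two_pow (hB : IsLoopBound B) (hF : FPTComputable Γ F)
    (hG : FPTComputable Γ G) (hFB : ∀ a, F a < 2 ^ B (Γ.inst a)) :
    FPTComputable Γ fun a => F a % 2 ^ G a := by
  have hk : FPTComputable Γ.ext.ext fun a => B (Γ.inst a.1.1) - 1 - a.1.2 :=
    ((hB.computable Γ).wk.wk.sub (.const _ 1)).sub (last Γ).wk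
  have hpow : FPTComputable Γ.ext.ext fun a => 2 ^ (B (Γ.inst a.1.1) - 1 - a.1.2) :=
    (two_pow_min hB hk).congr fun a => by rw [min_eq_left (by dsimp only [Context.ext]; lia)]
  refine (foldl (step := fun a acc j => if G a ≤ B (Γ.inst a) - 1 - j ∧
      2 ^ (B (Γ.inst a) - 1 - j) ≤ acc then acc - 2 ^ (B (Γ.inst a) - 1 - j) else acc) hB hF
    (ite (.and (.le hG.wk.wk hk) (.le hpow (last _))) ((last _).sub hpow) (last _))).congr
    fun a => ?_
  rw [foldl_sub_two_pow (hFB a) _ _ le_rfl, Nat.sub_self, max_eq_left (Nat.zero_le _)]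

/-- Finite sets of numbers below `B` that can be computed in fixed-parameter time. -/
def FPTFinset (Γ : Context P α) (B : P.Inst → ℕ) (S : α → Finset ℕ) : Prop :=
  ∃ F : α → ℕ, FPTComputable Γ F ∧ ∀ a, S a = decodeFinset (B (Γ.inst a)) (F a)

namespace FPTFinset

variable {S : α → Finset ℕ}

theorem subset (hS : FPTFinset Γ B S) (a : α) : S a ⊆ range (B (Γ.inst a)) := by
  obtain ⟨F, -, hSF⟩ := hS
  exact hSF a ▸ decodeFinset_subset _ _

theorem comp {S : β → Finset ℕ} (hS : FPTFinset Δ B S) (hf : FPTMap Γ Δ f) :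
    FPTFinset Γ B fun a => S (f a) := by
  obtain ⟨F, hF, hSF⟩ := hS
  exact ⟨_, hF.comp hf, fun a => hf.inst a ▸ hSF (f a)⟩

theorem wk (hS : FPTFinset Γ B S) : FPTFinset Γ.ext B fun a => S a.1 :=
  hS.comp (.wk (.id Γ))

theorem last (Γ : Context P α) (B : P.Inst → ℕ) :
    FPTFinset Γ.ext B fun a => decodeFinset (B (Γ.inst a.1)) a.2 :=
  ⟨_, .last Γ, fun _ => rfl⟩

theorem empty (Γ : Context P α) (B : P.Inst → ℕ) : FPTFinset Γ B fun _ => ∅ :=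
  ⟨_, .const Γ 0, fun _ => by rw [← sum_empty, decodeFinset_sum_two_pow (empty_subset _)]⟩

theorem mem (hB : IsLoopBound B) (hS : FPTFinset Γ B S) (hF : FPTComputable Γ F) :
    FPTDecidable Γ fun a => F a ∈ S a := by
  obtain ⟨C, hC, hSC⟩ := hS
  have hlt : FPTDecidable Γ fun a => C a < 2 ^ B (Γ.inst a) :=
    (FPTDecidable.lt hC (.two_pow_min hB (hB.computable Γ))).congr fun a => by rw [min_self]
  have hC' := FPTComputable.ite hlt hC (.const Γ 0)
  refine (FPTDecidable.le (.two_pow_min hB hF) (.mod_two_pow hB hC' (hF.add (.const Γ 1))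
    fun a => ?_)).congr fun a => ?_
  · split_ifs with h
    exacts [h, Nat.two_pow_pos _]
  · rw [hSC, mem_decodeFinset]
    split_ifs with h
    · obtain hle | hlt := le_or_gt (F a) (B (Γ.inst a))
      · simpa [h, hle] using two_pow_le_mod_iff_testBit (C a) (F a)
      · have hF : C a < 2 ^ F a := h.trans (Nat.pow_lt_pow_right one_lt_two hlt)
        simpa [hlt.le, Nat.testBit_eq_false_of_lt hF] using (Nat.mod_le _ _).trans_lt h
    · simp [h]

theorem of_subset (hB : IsLoopBound B) (hS : ∀ a, S a ⊆ range (B (Γ.inst a)))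
    (hmem : FPTDecidable Γ.ext fun a => a.2 ∈ S a.1) : FPTFinset Γ B S := by
  refine ⟨fun a => ∑ i ∈ S a, 2 ^ i, ?_, fun a => (decodeFinset_sum_two_pow (hS a)).symm⟩
  refine (FPTComputable.sum (f := fun a i => if i ∈ S a then 2 ^ min i (B (Γ.inst a)) else 0) hB
    (.ite hmem (.two_pow_min hB (.last Γ)) (.const _ 0))).congr fun a => ?_
  rw [← sum_filter, filter_mem_eq_inter, inter_eq_right.2 (hS a)]
  exact sum_congr rfl fun i hi => by rw [min_eq_left (mem_range.1 (hS a hi)).le]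

theorem filter {p : α → ℕ → Prop} [∀ a, DecidablePred (p a)] (hB : IsLoopBound B)
    (hp : FPTDecidable Γ.ext fun a => p a.1 a.2) :
    FPTFinset Γ B fun a => {i ∈ range (B (Γ.inst a)) | p a i} :=
  of_subset hB (fun _ => filter_subset _ _) (((FPTDecidable.lt (.last Γ) (hB.computable _)).and
    hp).congr fun a => by simp [Context.ext])

theorem foldl {step : α → Finset ℕ → ℕ → Finset ℕ} (hB' : IsLoopBound B') (hS : FPTFinset Γ B S)
    (hstep : FPTFinset Γ.ext.ext B fun a =>
      step a.1.1 (decodeFinset (B (Γ.inst a.1.1)) a.2) a.1.2) :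
    FPTFinset Γ B fun a => (List.range (B' (Γ.inst a))).foldl (step a) (S a) := by
  obtain ⟨F, hF, hSF⟩ := hS
  obtain ⟨G, hG, hstepG⟩ := hstep
  refine ⟨_, .foldl (step := fun a acc i => G ((a, i), acc)) hB' hF hG, fun a => ?_⟩
  simp only [hSF]
  refine List.foldl_hom _ ?_
  exact fun acc i => hstepG ((a, i), acc)

end FPTFinset

namespace FPTComputable

variable {S : α → Finset ℕ}

theorem sum_mem {f : α → ℕ → ℕ} (hB : IsLoopBound B) (hS : FPTFinset Γ B S)
    (hf : FPTComputable Γ.ext fun a => f a.1 a.2) : FPTComputable Γ fun a => ∑ i ∈ S a, f a i := by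
  refine (sum (f := fun a i => if i ∈ S a then f a i else 0) hB
    (ite (hS.wk.mem hB (last Γ)) hf (.const _ 0))).congr fun a => ?_
  rw [← sum_filter, filter_mem_eq_inter, inter_eq_right.2 (hS.subset a)]

theorem card (hB : IsLoopBound B) (hS : FPTFinset Γ B S) : FPTComputable Γ fun a => #(S a) :=
  (sum_mem hB hS (const _ 1)).congr fun _ => (card_eq_sum_ones _).symm

end FPTComputable

namespace FPTDecidable

variable {S : α → Finset ℕ}

theorem exists_lt {p : α → ℕ → Prop} (hB : IsLoopBound B)
    (hp : FPTDecidable Γ.ext fun a => p a.1 a.2) :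
    FPTDecidable Γ fun a => ∃ i < B (Γ.inst a), p a i := by
  obtain ⟨F, hF, hpF⟩ := hp
  refine (ne_zero (.sum (f := fun a i => F (a, i)) hB hF)).congr fun a => ?_
  simp only [ne_eq, sum_eq_zero_iff, mem_range, not_forall, exists_prop]
  exact exists_congr fun i => and_congr_right fun _ => (hpF (a, i)).symm

theorem exists_mem {p : α → ℕ → Prop} (hB : IsLoopBound B) (hS : FPTFinset Γ B S)
    (hp : FPTDecidable Γ.ext fun a => p a.1 a.2) : FPTDecidable Γ fun a => ∃ i ∈ S a, p a i :=
  (exists_lt (p := fun a i => i ∈ S a ∧ p a i) hB ((hS.wk.mem hB (.last Γ)).and hp)).congr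
    fun a => ⟨fun ⟨i, _, hi⟩ => ⟨i, hi⟩,
      fun ⟨i, hi, hpi⟩ => ⟨i, mem_range.1 (hS.subset a hi), hi, hpi⟩⟩

theorem forall_mem {p : α → ℕ → Prop} (hB : IsLoopBound B) (hS : FPTFinset Γ B S)
    (hp : FPTDecidable Γ.ext fun a => p a.1 a.2) : FPTDecidable Γ fun a => ∀ i ∈ S a, p a i :=
  (exists_mem (p := fun a i => ¬ p a i) hB hS hp.not).not.congr fun _ => by simp

theorem exists_subset {p : α → Finset ℕ → Prop} (hB : IsLoopBound B)
    (hB' : IsLoopBound fun x => 2 ^ B x) (hS : FPTFinset Γ B S)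
    (hp : FPTDecidable Γ.ext fun a => p a.1 (decodeFinset (B (Γ.inst a.1)) a.2)) :
    FPTDecidable Γ fun a => ∃ T ⊆ S a, p a T := by
  have hsub : FPTDecidable Γ.ext fun a => decodeFinset (B (Γ.inst a.1)) a.2 ⊆ S a.1 :=
    forall_mem (p := fun a i => i ∈ S a.1) hB (.last Γ B) (hS.wk.wk.mem hB (.last _))
  refine (exists_lt (p := fun a i => decodeFinset (B (Γ.inst a)) i ⊆ S a ∧
    p a (decodeFinset (B (Γ.inst a)) i)) hB' (hsub.and hp)).congr fun a =>
    ⟨fun ⟨i, _, hi⟩ => ⟨_, hi⟩,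
      fun ⟨T, hT, hpT⟩ => ⟨_, sum_two_pow_lt (hT.trans (hS.subset a)), ?_⟩⟩
  rw [decodeFinset_sum_two_pow (hT.trans (hS.subset a))]
  exact ⟨hT, hpT⟩

theorem forall_subset {p : α → Finset ℕ → Prop} (hB : IsLoopBound B)
    (hB' : IsLoopBound fun x => 2 ^ B x) (hS : FPTFinset Γ B S)
    (hp : FPTDecidable Γ.ext fun a => p a.1 (decodeFinset (B (Γ.inst a.1)) a.2)) :
    FPTDecidable Γ fun a => ∀ T ⊆ S a, p a T :=
  (exists_subset (p := fun a T => ¬ p a T) hB hB' hS hp.not).not.congr fun _ => by simp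

end FPTDecidable

namespace FPTFinset

variable {S T : α → Finset ℕ}

theorem sdiff (hB : IsLoopBound B) (hS : FPTFinset Γ B S) (hT : FPTFinset Γ B T) :
    FPTFinset Γ B fun a => S a \ T a :=
  of_subset hB (fun a => sdiff_subset.trans (hS.subset a)) <|
    ((hS.wk.mem hB (.last Γ)).and (hT.wk.mem hB (.last Γ)).not).congr fun _ => mem_sdiff.symm

theorem union (hB : IsLoopBound B) (hS : FPTFinset Γ B S) (hT : FPTFinset Γ B T) :
    FPTFinset Γ B fun a => S a ∪ T a :=
  of_subset hB (fun a => union_subset (hS.subset a) (hT.subset a)) <|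
    ((hS.wk.mem hB (.last Γ)).or (hT.wk.mem hB (.last Γ))).congr fun _ => mem_union.symm

theorem disjoint (hB : IsLoopBound B) (hS : FPTFinset Γ B S) (hT : FPTFinset Γ B T) :
    FPTDecidable Γ fun a => Disjoint (S a) (T a) :=
  (FPTDecidable.forall_mem (p := fun a i => i ∉ T a) hB hS
    (hT.wk.mem hB (.last Γ)).not).congr fun _ => disjoint_left.symm

theorem ite [DecidablePred p] (hp : FPTDecidable Γ p) (hS : FPTFinset Γ B S)
    (hT : FPTFinset Γ B T) : FPTFinset Γ B fun a => if p a then S a else T a := by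
  obtain ⟨F, hF, hSF⟩ := hS
  obtain ⟨G, hG, hTG⟩ := hT
  exact ⟨_, .ite hp hF hG, fun a => by simp only [apply_ite (decodeFinset _), hSF, hTG]⟩

theorem filter_mem {p : α → ℕ → Prop} [∀ a, DecidablePred (p a)] (hB : IsLoopBound B)
    (hS : FPTFinset Γ B S) (hp : FPTDecidable Γ.ext fun a => p a.1 a.2) :
    FPTFinset Γ B fun a => {i ∈ S a | p a i} :=
  of_subset hB (fun a => (filter_subset _ _).trans (hS.subset a))
    (((hS.wk.mem hB (.last Γ)).and hp).congr fun _ => mem_filter.symm)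

theorem range (hB : IsLoopBound B) (Γ : Context P α) :
    FPTFinset Γ B fun a => range (B (Γ.inst a)) :=
  of_subset hB (fun _ => subset_rfl) ((FPTDecidable.lt (.last Γ) (hB.computable _)).congr
    fun _ => mem_range.symm)

theorem biUnion {N : α → ℕ → Finset ℕ} (hB : IsLoopBound B) (hB' : IsLoopBound B')
    (hS : FPTFinset Γ B' S) (hN : FPTFinset Γ.ext B fun a => N a.1 a.2) :
    FPTFinset Γ B fun a => (S a).biUnion (N a) :=
  of_subset hB (fun a => biUnion_subset.2 fun i _ => hN.subset (a, i)) <|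
    (FPTDecidable.exists_mem (p := fun a i => a.2 ∈ N a.1 i) hB' hS.wk <|
      (hN.comp ((FPTMap.id Γ).wk.wk.ext (.last Γ.ext))).mem hB (.wk (.last Γ))).congr
        fun _ => mem_biUnion.symm

end FPTFinset

end RAM

namespace EquitableColoring

open Finset

/-! ### Combinatorial lemmas -/

section HittingSets

variable {V : Type*} [DecidableEq V]

/-- The greedy hitting set of a list of sets: every set of the list that is disjoint from the
elements collected so far is collected in full. -/
def greedyHittingSet (l : List (Finset V)) : Finset V :=
  l.foldl (fun U e => if Disjoint U e then U ∪ e else U) ∅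

theorem greedyHittingSet_concat (l : List (Finset V)) (e : Finset V) :
    greedyHittingSet (l ++ [e]) =
      if Disjoint (greedyHittingSet l) e then greedyHittingSet l ∪ e else greedyHittingSet l := by
  rw [greedyHittingSet, List.foldl_concat]
  rfl

theorem not_disjoint_greedyHittingSet {l : List (Finset V)} {e : Finset V} (he : e ∈ l)
    (hne : e.Nonempty) : ¬ Disjoint (greedyHittingSet l) e := by
  induction l using List.reverseRecOn with
  | nil => simp at he
  | append_singleton l e' ih =>
    rw [greedyHittingSet_concat]
    obtain he | rfl : e ∈ l ∨ e = e' := by simpa using he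
    · split_ifs
      · exact fun h => ih he (h.mono_left subset_union_left)
      · exact ih he
    · split_ifs with h
      · exact fun h' => hne.ne_empty (disjoint_self.1 (h'.mono_left subset_union_right))
      · exact h

theorem greedyHittingSet_subset {l : List (Finset V)} {W : Finset V} (h : ∀ e ∈ l, e ⊆ W) :
    greedyHittingSet l ⊆ W := by
  induction l using List.reverseRecOn with
  | nil => exact empty_subset W
  | append_singleton l e ih =>
    rw [List.forall_mem_append, List.forall_mem_singleton] at h
    rw [greedyHittingSet_concat]
    split_ifs
    · exact union_subset (ih h.1) h.2
    · exact ih h.1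

theorem card_greedyHittingSet_le {l : List (Finset V)} {d : ℕ} {T : Finset V}
    (hd : ∀ e ∈ l, #e ≤ d) (hT : ∀ e ∈ l, e.Nonempty → ¬ Disjoint T e) :
    #(greedyHittingSet l) ≤ d * #T := by
  suffices h : #(greedyHittingSet l) ≤ d * #(greedyHittingSet l ∩ T) from
    h.trans (Nat.mul_le_mul_left d (card_le_card inter_subset_right))
  induction l using List.reverseRecOn with
  | nil => exact Nat.zero_le _
  | append_singleton l e ih =>
    rw [List.forall_mem_append, List.forall_mem_singleton] at hd hT
    have ih := ih hd.1 hT.1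
    rw [greedyHittingSet_concat]
    split_ifs with hdisj
    · obtain rfl | hne := e.eq_empty_or_nonempty
      · simpa using ih
      · have hpos : 0 < #(e ∩ T) := card_pos.2 <| by
          rw [inter_comm]
          exact not_disjoint_iff_nonempty_inter.1 (hT.2 hne)
        rw [card_union_of_disjoint hdisj, union_inter_distrib_right, card_union_of_disjoint
          (hdisj.mono inter_subset_left inter_subset_left), Nat.mul_add]
        exact Nat.add_le_add ih (hd.2.trans (Nat.le_mul_of_pos_right d hpos))
    · exact ih

end HittingSets

section Fibers

variable {ι κ V : Type*}

theorem exists_map_card_fiber_eq [DecidableEq ι] [Nonempty ι] {R : Finset κ} {I : Finset ι}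
    {r : ι → ℕ} (h : ∑ i ∈ I, r i = #R) :
    ∃ b : κ → ι, (∀ q ∈ R, b q ∈ I) ∧ ∀ i ∈ I, #{q ∈ R | b q = i} = r i := by
  classical
  induction I using Finset.induction_on generalizing R with
  | empty =>
    obtain rfl : R = ∅ := by simpa [eq_comm] using h
    exact ⟨fun _ => Classical.arbitrary ι, by simp, by simp⟩
  | insert i I hi ih =>
    rw [sum_insert hi] at h
    obtain ⟨Q, hQR, hQ⟩ := exists_subset_card_eq (show r i ≤ #R by lia)
    obtain ⟨b, hbI, hb⟩ := ih (R := R \ Q) (by rw [card_sdiff_of_subset hQR, hQ, ← h]; lia)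
    refine ⟨fun q => if q ∈ Q then i else b q, fun q hq => ?_, fun i' hi' => ?_⟩
    · dsimp only
      split_ifs with hqQ
      · exact mem_insert_self i I
      · exact mem_insert_of_mem (hbI q (mem_sdiff.2 ⟨hq, hqQ⟩))
    · obtain rfl | hi' := mem_insert.1 hi'
      · rw [← hQ]
        congr 1
        ext q
        have hne : q ∈ R → q ∉ Q → b q ≠ i' := fun hq hqQ hqi =>
          hi (hqi ▸ hbI q (mem_sdiff.2 ⟨hq, hqQ⟩))
        by_cases hqQ : q ∈ Q <;> simp_all [hQR _]
      · rw [← hb i' hi']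
        congr 1
        ext q
        have hne : i ≠ i' := fun hii => hi (hii ▸ hi')
        by_cases hqQ : q ∈ Q <;> simp [hqQ, hne]

theorem exists_map_card_fiber_le [DecidableEq ι] [Nonempty ι] {R : Finset κ} {I : Finset ι}
    {s : ℕ} (h₁ : #I * s ≤ #R) (h₂ : #R ≤ #I * (s + 1)) :
    ∃ b : κ → ι, (∀ q ∈ R, b q ∈ I) ∧
      ∀ i ∈ I, s ≤ #{q ∈ R | b q = i} ∧ #{q ∈ R | b q = i} ≤ s + 1 := by
  obtain ⟨J, hJI, hJ⟩ := exists_subset_card_eq (show #R - #I * s ≤ #I by lia)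
  obtain ⟨b, hbI, hb⟩ := exists_map_card_fiber_eq (R := R) (I := I)
    (r := fun i => s + if i ∈ J then 1 else 0) (by
      rw [sum_add_distrib, sum_const, smul_eq_mul, ← card_filter, filter_mem_eq_inter,
        inter_eq_right.2 hJI, hJ]
      lia)
  refine ⟨b, hbI, fun i hi => ?_⟩
  rw [hb i hi]
  split_ifs <;> lia

theorem card_le_card_biUnion_sigma [DecidableEq V] {N : ι → Finset V} {d : ι → ℕ}
    (h : ∀ T : Finset ι, ∑ j ∈ T, d j ≤ #(T.biUnion N)) (s : Finset (Σ j, Fin (d j))) :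
    #s ≤ #(s.biUnion fun i => N i.1) := by
  classical
  have hs : s ⊆ (s.image Sigma.fst).sigma fun _ => univ := fun i hi => by
    simpa using ⟨i.2, hi⟩
  calc #s ≤ ∑ j ∈ s.image Sigma.fst, d j := by simpa using card_le_card hs
    _ ≤ #((s.image Sigma.fst).biUnion N) := h _
    _ = _ := by rw [image_biUnion]

/-- Apply Hall's marriage theorem to `d j` copies of each index `j`. -/
theorem exists_pairwise_disjoint_subsets [DecidableEq V] {N : ι → Finset V} {d : ι → ℕ}
    (h : ∀ T : Finset ι, ∑ j ∈ T, d j ≤ #(T.biUnion N)) :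
    ∃ D : ι → Finset V, (∀ j, D j ⊆ N j ∧ #(D j) = d j) ∧
      Pairwise fun j j' => Disjoint (D j) (D j') := by
  obtain ⟨f, hf, hmem⟩ := (all_card_le_biUnion_card_iff_exists_injective _).1
    (card_le_card_biUnion_sigma h)
  refine ⟨fun j => univ.image fun i => f ⟨j, i⟩, fun j => ⟨?_, ?_⟩, fun j j' hjj' => ?_⟩
  · exact image_subset_iff.2 fun i _ => hmem ⟨j, i⟩
  · exact (card_image_of_injective univ (hf.comp sigma_mk_injective)).trans (card_fin _)
  · simp only [disjoint_left, mem_image, mem_univ, true_and]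
    rintro _ ⟨i, rfl⟩ ⟨i', hii'⟩
    exact hjj' (congrArg Sigma.fst (hf hii')).symm

end Fibers

theorem exists_perm_lt_card {K : ℕ} (s : Finset (Fin K)) :
    ∃ e : Equiv.Perm (Fin K), ∀ a ∈ s, (e a : ℕ) < #s := by
  have hcard : Fintype.card {a // a ∈ s} = Fintype.card {i : Fin K // (i : ℕ) < #s} := by
    rw [Fintype.card_coe, Fintype.card_subtype, Fin.card_filter_val_lt,
      min_eq_right (card_finset_fin_le s)]
  exact ⟨(Fintype.equivOfCardEq hcard).extendSubtype, fun a ha =>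
    Equiv.extendSubtype_mem (Fintype.equivOfCardEq hcard) a ha⟩

open SimpleGraph

/-! ### Co-cluster graphs and modulators -/

section CoCluster

variable {V : Type*} {G : SimpleGraph V} {a b c : V}

/-- An edge `ab` and a vertex `c` adjacent to neither end: the induced subgraphs of this kind are
the obstructions to being a co-cluster graph. -/
def IsObstruction (G : SimpleGraph V) (a b c : V) : Prop :=
  G.Adj a b ∧ ¬ G.Adj a c ∧ ¬ G.Adj b c

theorem not_isObstruction_of_isCoCluster (h : G.IsCoCluster) : ¬ IsObstruction G a b c := by
  rintro ⟨hab, hac, hbc⟩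
  have hac' : Gᶜ.Adj a c := ⟨fun hne => hbc (hne ▸ hab.symm), hac⟩
  have hbc' : Gᶜ.Adj b c := ⟨fun hne => hac (hne ▸ hab), hbc⟩
  exact (h (Gᶜ.connectedComponentMk c) (ConnectedComponent.sound hac'.reachable)
    (ConnectedComponent.sound hbc'.reachable) hab.ne).2 hab

theorem exists_card_eq_distToCoCluster [Fintype V] (G : SimpleGraph V) :
    ∃ U : Finset V, #U = G.distToCoCluster ∧
      ∀ a b c, IsObstruction G a b c → a ∈ U ∨ b ∈ U ∨ c ∈ U := by
  obtain ⟨U, hU, hco⟩ := Nat.sInf_mem (s := {m | ∃ U : Finset V, #U = m ∧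
    (G.induce {v | v ∉ U}).IsCoCluster}) ⟨_, univ, rfl, fun _ v => absurd (mem_univ v.1) v.2⟩
  refine ⟨U, hU, fun a b c habc => ?_⟩
  by_contra! hnot
  have hco := not_isObstruction_of_isCoCluster hco (a := ⟨a, hnot.1⟩) (b := ⟨b, hnot.2.1⟩)
    (c := ⟨c, hnot.2.2⟩)
  exact hco habc

end CoCluster

section Modulator

open Classical in
/-- The vertex set of an obstruction among the vertices below `n`, and the empty set for a triple
that is not an obstruction. -/
noncomputable def obstructionSet (H : SimpleGraph ℕ) (n a b c : ℕ) : Finset ℕ :=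
  {v ∈ range n | IsObstruction H a b c ∧ (v = a ∨ v = b ∨ v = c)}

/-- The vertex sets of the obstructions among the vertices below `n`. -/
noncomputable def obstructions (H : SimpleGraph ℕ) (n : ℕ) : List (Finset ℕ) :=
  (List.range n).flatMap fun a => (List.range n).flatMap fun b =>
    (List.range n).map (obstructionSet H n a b)

/-- The vertices deleted by the algorithm to obtain a co-cluster graph. -/
noncomputable def modulator (H : SimpleGraph ℕ) (n : ℕ) : Finset ℕ :=
  greedyHittingSet (obstructions H n)

variable {H : SimpleGraph ℕ} {n a b c v : ℕ}

theorem mem_obstructionSet : v ∈ obstructionSet H n a b c ↔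
    v < n ∧ IsObstruction H a b c ∧ (v = a ∨ v = b ∨ v = c) := by
  simp [obstructionSet]

theorem mem_obstructions {e : Finset ℕ} :
    e ∈ obstructions H n ↔ ∃ a < n, ∃ b < n, ∃ c < n, obstructionSet H n a b c = e := by
  simp [obstructions]

theorem modulator_subset : modulator H n ⊆ range n := by
  refine greedyHittingSet_subset fun e he v hv => ?_
  obtain ⟨a, -, b, -, c, -, rfl⟩ := mem_obstructions.1 he
  exact mem_range.2 (mem_obstructionSet.1 hv).1

theorem not_isObstruction_of_mem_sdiff (ha : a ∈ range n \ modulator H n)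
    (hb : b ∈ range n \ modulator H n) (hc : c ∈ range n \ modulator H n) :
    ¬ IsObstruction H a b c := by
  intro h
  rw [mem_sdiff, mem_range] at ha hb hc
  refine not_disjoint_greedyHittingSet (mem_obstructions.2 ⟨a, ha.1, b, hb.1, c, hc.1, rfl⟩)
    ⟨a, mem_obstructionSet.2 ⟨ha.1, h, .inl rfl⟩⟩ (disjoint_right.2 fun v hv => ?_)
  obtain ⟨-, -, rfl | rfl | rfl⟩ := mem_obstructionSet.1 hv
  exacts [ha.2, hb.2, hc.2]

theorem card_modulator_le {T : Finset ℕ}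
    (hT : ∀ a b c, IsObstruction H a b c → c < n → a ∈ T ∨ b ∈ T ∨ c ∈ T) :
    #(modulator H n) ≤ 3 * #T := by
  refine card_greedyHittingSet_le (fun e he => ?_) fun e he ⟨v, hv⟩ => ?_ <;>
    obtain ⟨a, ha, b, hb, c, hc, rfl⟩ := mem_obstructions.1 he
  · refine (card_le_card fun v hv => ?_).trans (card_le_three (a := a) (b := b) (c := c))
    simpa using (mem_obstructionSet.1 hv).2.2
  · have h := (mem_obstructionSet.1 hv).2.1
    rw [not_disjoint_iff]
    obtain haT | hbT | hcT := hT a b c h hc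
    exacts [⟨a, haT, mem_obstructionSet.2 ⟨ha, h, .inl rfl⟩⟩,
      ⟨b, hbT, mem_obstructionSet.2 ⟨hb, h, .inr (.inl rfl)⟩⟩,
      ⟨c, hcT, mem_obstructionSet.2 ⟨hc, h, .inr (.inr rfl)⟩⟩]

end Modulator

section Parts

variable {H : SimpleGraph ℕ} {W : Finset ℕ} {v w i : ℕ}

/-- The least vertex in `W` not adjacent to `v`. If `W` induces a co-cluster graph and `v ∈ W`,
then it represents the part of `v` in this complete multipartite graph. -/
noncomputable def part (H : SimpleGraph ℕ) (W : Finset ℕ) (v : ℕ) : ℕ :=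
  sInf {w | w ∈ W ∧ ¬ H.Adj v w}

theorem isLeast_part (hv : v ∈ W) : IsLeast {w | w ∈ W ∧ ¬ H.Adj v w} (part H W v) :=
  ⟨Nat.sInf_mem ⟨v, hv, H.irrefl⟩, fun _ => Nat.sInf_le⟩

theorem part_mem (hv : v ∈ W) : part H W v ∈ W := (isLeast_part hv).1.1

theorem part_eq_iff (hv : v ∈ W) :
    part H W v = i ↔ (i ∈ W ∧ ¬ H.Adj v i) ∧ ∀ w < i, w ∈ W → H.Adj v w := by
  rw [← (isLeast_part hv).isLeast_iff_eq]
  refine and_congr Iff.rfl (forall_congr' fun w => ?_)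
  simp only [Set.mem_ofPred_eq, ← not_lt]
  tauto

theorem adj_iff_part_ne (hW : ∀ a ∈ W, ∀ b ∈ W, ∀ c ∈ W, ¬ IsObstruction H a b c) (hv : v ∈ W)
    (hw : w ∈ W) : H.Adj v w ↔ part H W v ≠ part H W w := by
  refine ⟨fun hvw hp => ?_, not_imp_comm.1 fun hvw => congrArg sInf (Set.ext fun u => ?_)⟩
  · exact hW v hv w hw _ (part_mem hv) ⟨hvw, (isLeast_part hv).1.2, hp ▸ (isLeast_part hw).1.2⟩
  · refine and_congr_right fun hu => not_congr ⟨fun h => ?_, fun h => ?_⟩ <;> by_contra hnot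
    · exact hW v hv u hu w hw ⟨h, hvw, fun h' => hnot h'.symm⟩
    · exact hW w hw u hu v hv ⟨h, fun h' => hvw h'.symm, fun h' => hnot h'.symm⟩

end Parts

/-! ### Balanced colorings -/

section Equitable

variable {V : Type*} [Fintype V] {G : SimpleGraph V} {k : ℕ}

open Classical in
theorem equitablyColorable_iff : G.EquitablyColorable k ↔ ∃ φ : G.Coloring (Fin k), ∀ i,
    Fintype.card V / k ≤ #{v | φ v = i} ∧ #{v | φ v = i} ≤ Fintype.card V / k + 1 := by
  have hncard (φ : G.Coloring (Fin k)) (i) : (φ.colorClass i).ncard = #{v | φ v = i} := by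
    rw [← Set.ncard_coe_finset, coe_filter_univ]
    rfl
  simp only [EquitablyColorable, hncard]
  refine exists_congr fun φ => ⟨fun h i => ⟨(h i).1, (h i).2.trans ?_⟩, fun h i => ⟨(h i).1, ?_⟩⟩
  · rw [ceilDiv_le_iff_le_smul i.pos, smul_eq_mul]
    exact (Nat.lt_mul_div_succ _ i.pos).le
  · by_contra! hlt
    have hceil : Fintype.card V ≤ k * (Fintype.card V ⌈/⌉ k) := le_smul_ceilDiv i.pos
    have hsum : k * (Fintype.card V / k) < Fintype.card V := calc
      _ = ∑ _j : Fin k, Fintype.card V / k := by simp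
      _ < ∑ j, #{v | φ v = j} := sum_lt_sum (fun j _ => (h j).1)
        ⟨i, mem_univ i, (floorDiv_le_ceilDiv (a := k)).trans_lt hlt⟩
      _ = _ := (card_eq_sum_card_fiberwise fun v _ => mem_univ (φ v)).symm
    have hle := Nat.mul_le_mul_left k (Nat.lt_succ_iff.1 (hlt.trans_le (h i).2))
    exact (hceil.trans hle).not_gt hsum

theorem equitablyColorable_of_card_le (h : Fintype.card V ≤ k) : G.EquitablyColorable k := by
  classical
  obtain ⟨f⟩ := Function.Embedding.nonempty_of_card_le (h.trans_eq (Fintype.card_fin k).symm)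
  refine equitablyColorable_iff.2 ⟨.mk f fun hvw => f.injective.ne hvw.ne, fun i => ⟨?_, ?_⟩⟩
  · obtain hlt | heq := h.lt_or_eq
    · exact (Nat.div_eq_of_lt hlt).trans_le (Nat.zero_le _)
    · have hf := (Fintype.bijective_iff_injective_and_card f).2 ⟨f.injective, by simpa using heq⟩
      obtain ⟨v, hv⟩ := hf.2 i
      rw [heq, Nat.div_self i.pos]
      exact card_pos.2 ⟨v, mem_filter.2 ⟨mem_univ v, hv⟩⟩
  · refine (card_le_one.2 fun v hv w hw => f.injective ?_).trans (Nat.le_add_left 1 _)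
    exact (mem_filter.1 hv).2.trans (mem_filter.1 hw).2.symm

theorem equitablyColorable_min_card :
    G.EquitablyColorable (min k (Fintype.card V)) ↔ G.EquitablyColorable k := by
  obtain h | h := le_total k (Fintype.card V)
  · rw [min_eq_left h]
  · rw [min_eq_right h]
    exact iff_of_true (equitablyColorable_of_card_le le_rfl) (equitablyColorable_of_card_le h)

end Equitable

/-- `φ` is a proper coloring of the subgraph induced by `W`, the colors are those in `R`, and each
of them is used `s` or `s + 1` times. -/
structure IsBalancedColoring {V C : Type*} [DecidableEq C] (H : SimpleGraph V) (W : Finset V)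
    (R : Finset C) (s : ℕ) (φ : V → C) : Prop where
  mem : ∀ v ∈ W, φ v ∈ R
  proper : ∀ v ∈ W, ∀ w ∈ W, H.Adj v w → φ v ≠ φ w
  le_card : ∀ j ∈ R, s ≤ #{v ∈ W | φ v = j}
  card_le : ∀ j ∈ R, #{v ∈ W | φ v = j} ≤ s + 1

section Instances

variable {n K : ℕ} {G : SimpleGraph (Fin n)}

theorem map_adj_iff {v w : ℕ} (hv : v < n) (hw : w < n) :
    (G.map Fin.valEmbedding).Adj v w ↔ G.Adj ⟨v, hv⟩ ⟨w, hw⟩ :=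
  map_adj_apply (f := Fin.valEmbedding) (a := ⟨v, hv⟩) (b := ⟨w, hw⟩)

theorem card_filter_range (p : ℕ → Prop) [DecidablePred p] :
    #{v ∈ range n | p v} = #{v : Fin n | p v} := by
  simp only [card_filter, sum_range]

theorem exists_isBalancedColoring_iff_equitablyColorable {U : Finset ℕ} (hU : U ⊆ range n) :
    (∃ φ, IsBalancedColoring (G.map Fin.valEmbedding) (range n) (range K) (n / K) φ ∧
      ∀ v ∈ U, φ v < min #U K) ↔ G.EquitablyColorable K := by
  rw [equitablyColorable_iff]
  rw [Fintype.card_fin]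
  constructor
  · rintro ⟨φ, hφ, -⟩
    refine ⟨.mk (fun v => ⟨φ v, mem_range.1 (hφ.mem v (mem_range.2 v.2))⟩) fun {v w} hvw h => ?_,
      fun i => ?_⟩
    · exact hφ.proper v (mem_range.2 v.2) w (mem_range.2 w.2) ((map_adj_iff v.2 w.2).2 hvw)
        (congrArg Fin.val h)
    · have h := And.intro (hφ.le_card i (mem_range.2 i.2)) (hφ.card_le i (mem_range.2 i.2))
      simp only [card_filter_range] at h
      simp only [Fin.ext_iff]
      exact h
  · rintro ⟨φ, hφ⟩
    obtain ⟨e, he⟩ := exists_perm_lt_card (image φ {v | (v : ℕ) ∈ U})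
    set ψ : ℕ → ℕ := fun v => if hv : v < n then e (φ ⟨v, hv⟩) else 0
    have hψ (v : Fin n) : ψ v = e (φ v) := by simp [ψ]
    have hclass (j) (hj : j < K) : #{v ∈ range n | ψ v = j} = #{v | φ v = e.symm ⟨j, hj⟩} := by
      simp only [card_filter_range, hψ, Equiv.eq_symm_apply, Fin.ext_iff]
    refine ⟨ψ, ⟨fun v hv => ?_, fun v hv w hw hvw => ?_, fun j hj => ?_, fun j hj => ?_⟩,
      fun v hv => ?_⟩
    · lift v to Fin n using mem_range.1 hv
      simp only [hψ, mem_range, Fin.is_lt]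
    · lift v to Fin n using mem_range.1 hv
      lift w to Fin n using mem_range.1 hw
      rw [hψ, hψ, Fin.val_ne_iff]
      exact e.injective.ne (φ.valid ((map_adj_iff v.2 w.2).1 hvw))
    · exact hclass j (mem_range.1 hj) ▸ (hφ _).1
    · exact hclass j (mem_range.1 hj) ▸ (hφ _).2
    · lift v to Fin n using mem_range.1 (hU hv)
      have hcard : #(image φ {v | (v : ℕ) ∈ U}) ≤ #U := card_image_le.trans <| by
        rw [← card_filter_range (fun v => v ∈ U), filter_mem_eq_inter]
        exact card_le_card inter_subset_right
      rw [hψ, lt_min_iff]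
      exact ⟨(he _ (mem_image_of_mem φ (by simpa using hv))).trans_le hcard, (e _).2⟩

end Instances

/-! ### Extending a coloring of the modulator -/

section OnePart

variable {V C : Type*} [DecidableEq V] [DecidableEq C] {A : Finset V} {N : C → Finset V}
  {d : C → ℕ} {s r : ℕ} {S Q : Finset C} {ψ : V → C}

/-- A coloring of `A` that uses each color `j ∈ S` exactly `d j` times, only at vertices in `N j`,
and each color in `Q` exactly `s` or `s + 1` times. -/
structure FillsPart (A : Finset V) (N : C → Finset V) (d : C → ℕ) (s : ℕ) (S Q : Finset C)
    (ψ : V → C) : Prop where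
  mem : ∀ v ∈ A, ψ v ∈ S ∪ Q
  mem_avail : ∀ v ∈ A, ψ v ∈ S → v ∈ N (ψ v)
  card_eq : ∀ j ∈ S, #{v ∈ A | ψ v = j} = d j
  le_card : ∀ q ∈ Q, s ≤ #{v ∈ A | ψ v = q}
  card_le : ∀ q ∈ Q, #{v ∈ A | ψ v = q} ≤ s + 1

/-- The counting conditions for the existence of a coloring with `FillsPart`, where `r` is the
number of colors in `Q`. -/
structure HallCondition (A : Finset V) (N : C → Finset V) (d : C → ℕ) (s : ℕ) (S : Finset C)
    (r : ℕ) : Prop where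
  hall : ∀ T ⊆ S, ∑ j ∈ T, d j ≤ #(T.biUnion N)
  le_card : r * s + ∑ j ∈ S, d j ≤ #A
  card_le : #A ≤ r * (s + 1) + ∑ j ∈ S, d j

omit [DecidableEq V] in
theorem FillsPart.congr {ψ' : V → C} (h : FillsPart A N d s S Q ψ) (heq : ∀ v ∈ A, ψ' v = ψ v) :
    FillsPart A N d s S Q ψ' := by
  have hfilter (c) : {v ∈ A | ψ' v = c} = {v ∈ A | ψ v = c} :=
    filter_congr fun v hv => by rw [heq v hv]
  refine ⟨fun v hv => ?_, fun v hv => ?_, ?_, ?_, ?_⟩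
  · exact heq v hv ▸ h.mem v hv
  · exact heq v hv ▸ h.mem_avail v hv
  · simpa only [hfilter] using h.card_eq
  · simpa only [hfilter] using h.le_card
  · simpa only [hfilter] using h.card_le

theorem FillsPart.hallCondition (h : FillsPart A N d s S Q ψ) (hSQ : Disjoint S Q) :
    HallCondition A N d s S #Q := by
  have hA : #A = ∑ q ∈ Q, #{v ∈ A | ψ v = q} + ∑ j ∈ S, d j := by
    rw [card_eq_sum_card_fiberwise h.mem, sum_union hSQ, sum_congr rfl h.card_eq, add_comm]
  refine ⟨fun T hT => ?_, ?_, ?_⟩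
  · rw [sum_congr rfl fun j hj => (h.card_eq j (hT hj)).symm, ← card_biUnion
      fun i _ j _ hij => disjoint_filter.2 fun _ _ hi hj => hij (hi.symm.trans hj)]
    refine card_le_card (biUnion_mono fun j hj v hv => ?_)
    obtain ⟨hvA, rfl⟩ := mem_filter.1 hv
    exact h.mem_avail v hvA (hT hj)
  · rw [hA]
    exact Nat.add_le_add_right (card_nsmul_le_sum Q _ s h.le_card) _
  · rw [hA]
    exact Nat.add_le_add_right (sum_le_card_nsmul Q _ (s + 1) h.card_le) _

theorem exists_map_fiber_eq [Nonempty C] {K : Finset C} {E : C → Finset V}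
    (hE : Pairwise fun i j => Disjoint (E i) (E j)) : ∃ ψ : V → C,
      (∀ v ∈ K.biUnion E, ψ v ∈ K ∧ v ∈ E (ψ v)) ∧
      ∀ j ∈ K, {v ∈ K.biUnion E | ψ v = j} = E j := by
  have hψ : ∀ j, ∀ v ∈ E j, (Classical.epsilon fun j => v ∈ E j) = j := fun j v hv => by
    by_contra hne
    exact disjoint_left.1 (hE hne) (Classical.epsilon_spec (p := fun j => v ∈ E j) ⟨j, hv⟩) hv
  refine ⟨fun v => Classical.epsilon fun j => v ∈ E j, fun v hv => ?_, fun j hj => ?_⟩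
  · obtain ⟨j, hj, hv⟩ := mem_biUnion.1 hv
    simp only [hψ j v hv, hj, hv, and_self]
  · ext v
    rw [mem_filter, mem_biUnion]
    refine ⟨fun ⟨⟨i, _, hv⟩, hvj⟩ => ?_, fun hv => ⟨⟨j, hj, hv⟩, hψ j v hv⟩⟩
    obtain rfl : i = j := (hψ i v hv).symm.trans hvj
    exact hv

theorem HallCondition.exists_fillsPart [Nonempty C] (h : HallCondition A N d s S #Q)
    (hN : ∀ j, N j ⊆ A) (hSQ : Disjoint S Q) : ∃ ψ, FillsPart A N d s S Q ψ := by
  obtain ⟨D, hD, hdisj⟩ := exists_pairwise_disjoint_subsets (N := N)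
    (d := fun j => if j ∈ S then d j else 0) fun T => by
      rw [← sum_filter, filter_mem_eq_inter]
      exact (h.hall _ inter_subset_right).trans
        (card_le_card (biUnion_subset_biUnion_of_subset_left _ inter_subset_left))
  have hDS : ∀ j ∈ S, #(D j) = d j := fun j hj => (hD j).2.trans (if_pos hj)
  have hDA : S.biUnion D ⊆ A := biUnion_subset.2 fun j _ => (hD j).1.trans (hN j)
  have hrest : #(A \ S.biUnion D) = #A - ∑ j ∈ S, d j := by
    rw [card_sdiff_of_subset hDA, card_biUnion fun i _ j _ hij => hdisj hij, sum_congr rfl hDS]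
  obtain ⟨b, hbQ, hb⟩ := exists_map_card_fiber_le (R := A \ S.biUnion D) (I := Q) (s := s)
    (by have := h.le_card; lia) (by have := h.card_le; lia)
  set E : C → Finset V := fun j => if j ∈ S then D j else {v ∈ A \ S.biUnion D | b v = j}
  have hES : ∀ j ∈ S, E j = D j := fun j hj => if_pos hj
  have hEQ : ∀ q ∈ Q, E q = {v ∈ A \ S.biUnion D | b v = q} := fun q hq =>
    if_neg (disjoint_right.1 hSQ hq)
  have hEdisj : Pairwise fun i j => Disjoint (E i) (E j) := fun i j hij => by
    simp only [E]
    split_ifs with hi hj hj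
    · exact hdisj hij
    · exact disjoint_sdiff.mono (subset_biUnion_of_mem D hi) (filter_subset _ _)
    · exact sdiff_disjoint.mono (filter_subset _ _) (subset_biUnion_of_mem D hj)
    · exact disjoint_filter.2 fun v _ hvi hvj => hij (hvi.symm.trans hvj)
  have hEA : (S ∪ Q).biUnion E = A := by
    rw [union_biUnion, biUnion_congr rfl hES, biUnion_congr rfl hEQ,
      biUnion_filter_eq_of_maps_to hbQ, union_sdiff_of_subset hDA]
  obtain ⟨ψ, hψ, hfiber⟩ := exists_map_fiber_eq (K := S ∪ Q) hEdisj
  simp only [hEA] at hψ hfiber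
  refine ⟨ψ, fun v hv => (hψ v hv).1, fun v hv hvS => ?_, fun j hj => ?_, fun q hq => ?_,
    fun q hq => ?_⟩
  · exact (hD _).1 (hES _ hvS ▸ (hψ v hv).2)
  · rw [hfiber j (mem_union_left _ hj), hES j hj, hDS j hj]
  · rw [hfiber q (mem_union_right _ hq), hEQ q hq]
    exact (hb q hq).1
  · rw [hfiber q (mem_union_right _ hq), hEQ q hq]
    exact (hb q hq).2

end OnePart

section Extension

variable {V C ι : Type*} [DecidableEq V] [DecidableEq C]

open Classical in
/-- The vertices in `A` that can receive color `j` next to the coloring `γ` of `U`. -/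
noncomputable def avail (H : SimpleGraph V) (U : Finset V) (γ : V → C) (A : Finset V) (j : C) :
    Finset V :=
  {v ∈ A | ∀ u ∈ U, γ u = j → ¬ H.Adj u v}

/-- The number of vertices outside `U` that must receive color `j` for its class to have size
`τ j`. -/
def demand (U : Finset V) (γ : V → C) (τ : C → ℕ) (j : C) : ℕ :=
  τ j - #{u ∈ U | γ u = j}

/-- `φ` extends the coloring `γ` of `U` to a proper coloring of the subgraph induced by `U ∪ X`, in
which each color `j ∈ J` is used exactly `τ j` times and each color in `R` is used `s` or `s + 1`
times. -/
structure IsExtension (H : SimpleGraph V) (U X : Finset V) (γ : V → C) (J R : Finset C) (τ : C → ℕ)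
    (s : ℕ) (φ : V → C) : Prop where
  eqOn : ∀ u ∈ U, φ u = γ u
  mem : ∀ v ∈ X, φ v ∈ J ∪ R
  proper : ∀ v ∈ U ∪ X, ∀ w ∈ U ∪ X, H.Adj v w → φ v ≠ φ w
  card_eq : ∀ j ∈ J, #{v ∈ U ∪ X | φ v = j} = τ j
  le_card : ∀ q ∈ R, s ≤ #{v ∈ U ∪ X | φ v = q}
  card_le : ∀ q ∈ R, #{v ∈ U ∪ X | φ v = q} ≤ s + 1

variable {H : SimpleGraph V} {U X : Finset V} {γ φ : V → C} {J R : Finset C} {τ : C → ℕ} {s : ℕ}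

omit [DecidableEq V] in
theorem mem_avail {A : Finset V} {v : V} {j : C} :
    v ∈ avail H U γ A j ↔ v ∈ A ∧ ∀ u ∈ U, γ u = j → ¬ H.Adj u v := by
  simp only [avail, mem_filter]

theorem card_filter_union (hUX : Disjoint U X) (heq : ∀ u ∈ U, φ u = γ u) (c : C) :
    #{v ∈ U ∪ X | φ v = c} = #{u ∈ U | γ u = c} + #{v ∈ X | φ v = c} := by
  rw [filter_union, card_union_of_disjoint (disjoint_filter_filter hUX),
    filter_congr fun u hu => by rw [heq u hu]]

theorem card_filter_union_of_notMem (hUX : Disjoint U X) (heq : ∀ u ∈ U, φ u = γ u)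
    (hγ : ∀ u ∈ U, γ u ∈ J) {c : C} (hc : c ∉ J) :
    #{v ∈ U ∪ X | φ v = c} = #{v ∈ X | φ v = c} := by
  have hU : {u ∈ U | γ u = c} = ∅ := filter_false_of_mem fun u hu huc => hc (huc ▸ hγ u hu)
  rw [card_filter_union hUX heq, hU, card_empty, zero_add]

theorem proper_union (hγ : ∀ u ∈ U, γ u ∈ J) (heq : ∀ u ∈ U, φ u = γ u)
    (hU : ∀ v ∈ U, ∀ w ∈ U, H.Adj v w → γ v ≠ γ w)
    (hX : ∀ v ∈ X, ∀ w ∈ X, H.Adj v w → φ v ≠ φ w)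
    (havail : ∀ v ∈ X, φ v ∈ J → v ∈ avail H U γ X (φ v)) :
    ∀ v ∈ U ∪ X, ∀ w ∈ U ∪ X, H.Adj v w → φ v ≠ φ w := by
  have hUX : ∀ u ∈ U, ∀ x ∈ X, H.Adj u x → φ u ≠ φ x := fun u hu x hx hux hφ => by
    rw [heq u hu] at hφ
    exact (mem_avail.1 (havail x hx (hφ ▸ hγ u hu))).2 u hu hφ hux
  intro v hv w hw hvw
  obtain hvU | hvX := mem_union.1 hv <;> obtain hwU | hwX := mem_union.1 hw
  · rw [heq v hvU, heq w hwU]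
    exact hU v hvU w hwU hvw
  · exact hUX v hvU w hwX hvw
  · exact (hUX w hwU v hvX hvw.symm).symm
  · exact hX v hvX w hwX hvw

variable {rep : V → ι} {home : C → ι} {I : Finset ι}

theorem IsExtension.exists_home (h : IsExtension H U X γ J R τ s φ) (hne : I.Nonempty)
    (hrep : ∀ v ∈ X, ∀ w ∈ X, rep v ≠ rep w → H.Adj v w) (hI : ∀ v ∈ X, rep v ∈ I) :
    ∃ home : C → ι, (∀ c, home c ∈ I) ∧ ∀ v ∈ X, home (φ v) = rep v := by
  obtain ⟨i₀, hi₀⟩ := hne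
  have hhome (c) : ∃ i ∈ I, ∀ v ∈ X, φ v = c → i = rep v := by
    by_cases hc : ∃ v ∈ X, φ v = c
    · obtain ⟨v, hv, rfl⟩ := hc
      refine ⟨rep v, hI v hv, fun w hw hwv => ?_⟩
      by_contra hvw
      exact h.proper v (mem_union_right U hv) w (mem_union_right U hw) (hrep v hv w hw hvw) hwv.symm
    · exact ⟨i₀, hi₀, fun v hv hvc => absurd ⟨v, hv, hvc⟩ hc⟩
  choose home hhomeI hhome using hhome
  exact ⟨home, hhomeI, fun v hv => hhome _ v hv rfl⟩

variable [DecidableEq ι]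

omit [DecidableEq V] in
theorem card_filter_home (hhome : ∀ v ∈ X, home (φ v) = rep v) (c : C) :
    #{v ∈ {v ∈ X | rep v = home c} | φ v = c} = #{v ∈ X | φ v = c} := by
  rw [filter_filter, filter_congr fun v hv =>
    and_iff_right_of_imp fun hvc => (hhome v hv).symm.trans (congrArg home hvc)]

theorem IsExtension.fillsPart (h : IsExtension H U X γ J R τ s φ) (hUX : Disjoint U X)
    (hJR : Disjoint J R) (hγ : ∀ u ∈ U, γ u ∈ J) (hhome : ∀ v ∈ X, home (φ v) = rep v) (i : ι) :
    FillsPart {v ∈ X | rep v = i} (avail H U γ {v ∈ X | rep v = i}) (demand U γ τ) s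
      {j ∈ J | home j = i} {q ∈ R | home q = i} φ := by
  have hR : ∀ q ∈ R, #{v ∈ U ∪ X | φ v = q} = #{v ∈ {v ∈ X | rep v = home q} | φ v = q} :=
    fun q hq => by
      rw [card_filter_union_of_notMem hUX h.eqOn hγ (disjoint_right.1 hJR hq),
        card_filter_home hhome]
  refine ⟨fun v hv => ?_, fun v hv _ => ?_, fun j hj => ?_, fun q hq => ?_, fun q hq => ?_⟩
  · obtain ⟨hvX, rfl⟩ := mem_filter.1 hv
    rw [← filter_union]
    exact mem_filter.2 ⟨h.mem v hvX, hhome v hvX⟩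
  · refine mem_avail.2 ⟨hv, fun u hu huv hadj => ?_⟩
    exact h.proper u (mem_union_left X hu) v (mem_union_right U (mem_filter.1 hv).1) hadj
      ((h.eqOn u hu).trans huv)
  · obtain ⟨hj', rfl⟩ := mem_filter.1 hj
    rw [demand, ← h.card_eq j hj', card_filter_union hUX h.eqOn, card_filter_home hhome,
      Nat.add_sub_cancel_left]
  · obtain ⟨hq', rfl⟩ := mem_filter.1 hq
    exact hR q hq' ▸ h.le_card q hq'
  · obtain ⟨hq', rfl⟩ := mem_filter.1 hq
    exact hR q hq' ▸ h.card_le q hq'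

theorem isExtension_of_fillsPart (hUX : Disjoint U X) (hJR : Disjoint J R)
    (hγ : ∀ u ∈ U, γ u ∈ J) (hproper : ∀ v ∈ U, ∀ w ∈ U, H.Adj v w → γ v ≠ γ w)
    (hτ : ∀ j ∈ J, #{u ∈ U | γ u = j} ≤ τ j)
    (hrep : ∀ v ∈ X, ∀ w ∈ X, H.Adj v w → rep v ≠ rep w) (hI : ∀ v ∈ X, rep v ∈ I)
    (hhomeI : ∀ c ∈ J ∪ R, home c ∈ I) (heq : ∀ u ∈ U, φ u = γ u)
    (h : ∀ i ∈ I, FillsPart {v ∈ X | rep v = i} (avail H U γ {v ∈ X | rep v = i})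
      (demand U γ τ) s {j ∈ J | home j = i} {q ∈ R | home q = i} φ) :
    IsExtension H U X γ J R τ s φ := by
  have hmem : ∀ v ∈ X, φ v ∈ J ∪ R ∧ home (φ v) = rep v := fun v hv => by
    have := (h _ (hI v hv)).mem v (mem_filter.2 ⟨hv, rfl⟩)
    rwa [← filter_union, mem_filter] at this
  have hhome : ∀ v ∈ X, home (φ v) = rep v := fun v hv => (hmem v hv).2
  have hJI : ∀ j ∈ J, home j ∈ I := fun j hj => hhomeI j (mem_union_left R hj)
  have hRI : ∀ q ∈ R, home q ∈ I := fun q hq => hhomeI q (mem_union_right J hq)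
  have hR : ∀ q ∈ R, #{v ∈ U ∪ X | φ v = q} = #{v ∈ {v ∈ X | rep v = home q} | φ v = q} :=
    fun q hq => by
      rw [card_filter_union_of_notMem hUX heq hγ (disjoint_right.1 hJR hq), card_filter_home hhome]
  refine ⟨heq, fun v hv => (hmem v hv).1, proper_union hγ heq hproper (fun v hv w hw hvw hφ => ?_)
    fun v hv hvJ => ?_, fun j hj => ?_, fun q hq => ?_, fun q hq => ?_⟩
  · exact hrep v hv w hw hvw (by rw [← hhome v hv, ← hhome w hw, hφ])
  · have := (h _ (hI v hv)).mem_avail v (mem_filter.2 ⟨hv, rfl⟩) (mem_filter.2 ⟨hvJ, hhome v hv⟩)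
    exact mem_avail.2 ⟨hv, (mem_avail.1 this).2⟩
  · rw [card_filter_union hUX heq, ← card_filter_home hhome,
      (h _ (hJI j hj)).card_eq j (mem_filter.2 ⟨hj, rfl⟩), demand, Nat.add_sub_cancel' (hτ j hj)]
  · exact hR q hq ▸ (h _ (hRI q hq)).le_card q (mem_filter.2 ⟨hq, rfl⟩)
  · exact hR q hq ▸ (h _ (hRI q hq)).card_le q (mem_filter.2 ⟨hq, rfl⟩)

theorem exists_isExtension_iff [Nonempty C] (hUX : Disjoint U X) (hJR : Disjoint J R)
    (hγ : ∀ u ∈ U, γ u ∈ J) (hrep : ∀ v ∈ X, ∀ w ∈ X, H.Adj v w ↔ rep v ≠ rep w)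
    (hI : ∀ v ∈ X, rep v ∈ I) (hne : I.Nonempty) :
    (∃ φ, IsExtension H U X γ J R τ s φ) ↔
      (∀ v ∈ U, ∀ w ∈ U, H.Adj v w → γ v ≠ γ w) ∧ (∀ j ∈ J, #{u ∈ U | γ u = j} ≤ τ j) ∧
        ∃ home : C → ι, (∀ c ∈ J ∪ R, home c ∈ I) ∧ ∀ i ∈ I,
          HallCondition {v ∈ X | rep v = i} (avail H U γ {v ∈ X | rep v = i}) (demand U γ τ) s
            {j ∈ J | home j = i} #{q ∈ R | home q = i} := by
  constructor
  · rintro ⟨φ, h⟩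
    obtain ⟨home, hhomeI, hhome⟩ := h.exists_home hne (fun v hv w hw => (hrep v hv w hw).2) hI
    refine ⟨fun v hv w hw hvw => ?_, fun j hj => ?_, home, fun c _ => hhomeI c, fun i _ => ?_⟩
    · rw [← h.eqOn v hv, ← h.eqOn w hw]
      exact h.proper v (mem_union_left X hv) w (mem_union_left X hw) hvw
    · rw [← h.card_eq j hj, card_filter_union hUX h.eqOn]
      exact Nat.le_add_right _ _
    · exact (h.fillsPart hUX hJR hγ hhome i).hallCondition (disjoint_filter_filter hJR)
  · rintro ⟨hproper, hτ, home, hhomeI, hHall⟩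
    have hfill (i) (hi : i ∈ I) := (hHall i hi).exists_fillsPart
      (fun j v hv => (mem_avail.1 hv).1) (disjoint_filter_filter hJR)
    choose! ψ hψ using hfill
    have hXU : ∀ v ∈ X, v ∉ U := fun _ hv => disjoint_right.1 hUX hv
    refine ⟨fun v => if v ∈ U then γ v else ψ (rep v) v, isExtension_of_fillsPart hUX hJR hγ hproper
      hτ (fun v hv w hw => (hrep v hv w hw).1) hI hhomeI (fun u hu => if_pos hu) fun i hi =>
      (hψ i hi).congr fun v hv => ?_⟩
    obtain ⟨hvX, rfl⟩ := mem_filter.1 hv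
    exact if_neg (hXU v hvX)

end Extension

/-! ### Distributing the colors among the parts -/

section Distribution

/-- The elements of `S` and `c` further indistinguishable elements can be distributed among the
places `0, …, t - 1` in such a way that `F i T r` holds for every place `i`, where `T` is the set of
elements of `S` and `r` the number of further elements put there. The recursion on `t` is that of
the dynamic program computing this predicate. -/
def IsDistributable {C : Type*} [DecidableEq C] (F : ℕ → Finset C → ℕ → Prop) :
    ℕ → Finset C → ℕ → Prop
  | 0, S, c => S = ∅ ∧ c = 0
  | t + 1, S, c => ∃ T ⊆ S, ∃ r ≤ c, IsDistributable F t T r ∧ F t (S \ T) (c - r)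

variable {C : Type*} [DecidableEq C] {F : ℕ → Finset C → ℕ → Prop} {t : ℕ}

theorem exists_map_lt_succ_iff {G : ℕ → Finset C → Prop} {Z : Finset C} :
    (∃ home : C → ℕ, (∀ c ∈ Z, home c < t + 1) ∧ ∀ i < t + 1, G i {c ∈ Z | home c = i}) ↔
      ∃ Y ⊆ Z, (∃ home : C → ℕ, (∀ c ∈ Y, home c < t) ∧ ∀ i < t, G i {c ∈ Y | home c = i}) ∧
        G t (Z \ Y) := by
  constructor
  · rintro ⟨home, hlt, hG⟩
    refine ⟨{c ∈ Z | home c < t}, filter_subset _ _, ⟨home, fun c hc => (mem_filter.1 hc).2,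
      fun i hi => ?_⟩, ?_⟩
    · rw [filter_filter, filter_congr fun c _ => and_iff_right_of_imp fun h => h.trans_lt hi]
      exact hG i (hi.trans t.lt_succ_self)
    · rw [← filter_not, filter_congr fun c hc => (show ¬ home c < t ↔ home c = t by grind)]
      exact hG t t.lt_succ_self
  · rintro ⟨Y, hYZ, ⟨home, hlt, hG⟩, hGt⟩
    refine ⟨fun c => if c ∈ Y then home c else t, fun c _ => by grind, fun i hi => ?_⟩
    obtain hi | rfl := Nat.lt_succ_iff_lt_or_eq.1 hi
    · convert hG i hi using 1
      grind
    · convert hGt using 1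
      grind

theorem exists_subset_exists_le_iff {S R Z : Finset C} (hSR : Disjoint S R)
    {P Q : Finset C → ℕ → Prop} :
    (∃ T ⊆ Z ∩ S, ∃ r ≤ #(Z ∩ R), P T r ∧ Q ((Z ∩ S) \ T) (#(Z ∩ R) - r)) ↔
      ∃ Y ⊆ Z, P (Y ∩ S) #(Y ∩ R) ∧ Q ((Z \ Y) ∩ S) #((Z \ Y) ∩ R) := by
  have hdiff (Y A : Finset C) : (Z \ Y) ∩ A = (Z ∩ A) \ (Y ∩ A) := by grind
  constructor
  · rintro ⟨T, hT, r, hr, hP, hQ⟩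
    obtain ⟨T', hT', rfl⟩ := exists_subset_card_eq hr
    have hS : (T ∪ T') ∩ S = T := by grind [Finset.disjoint_left]
    have hR : (T ∪ T') ∩ R = T' := by grind [Finset.disjoint_left]
    refine ⟨T ∪ T', by grind, ?_⟩
    rw [hdiff, hdiff, hS, hR, card_sdiff_of_subset hT']
    exact ⟨hP, hQ⟩
  · rintro ⟨Y, hY, hP, hQ⟩
    have hR : Y ∩ R ⊆ Z ∩ R := inter_subset_inter_right hY
    rw [hdiff, hdiff, card_sdiff_of_subset hR] at hQ
    exact ⟨Y ∩ S, inter_subset_inter_right hY, #(Y ∩ R), card_le_card hR, hP, hQ⟩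

theorem isDistributable_inter_iff {S R Z : Finset C} (hSR : Disjoint S R) (hZ : Z ⊆ S ∪ R) :
    IsDistributable F t (Z ∩ S) #(Z ∩ R) ↔ ∃ home : C → ℕ, (∀ c ∈ Z, home c < t) ∧
      ∀ i < t, F i ({c ∈ Z | home c = i} ∩ S) #({c ∈ Z | home c = i} ∩ R) := by
  induction t generalizing Z with
  | zero =>
    rw [IsDistributable, card_eq_zero, ← union_eq_empty, ← inter_union_distrib_left,
      inter_eq_left.2 hZ, eq_empty_iff_forall_notMem]
    simp
  | succ t ih =>
    rw [IsDistributable, exists_subset_exists_le_iff hSR,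
      exists_map_lt_succ_iff (G := fun i Y => F i (Y ∩ S) #(Y ∩ R))]
    exact exists_congr fun Y => and_congr_right fun hY => and_congr_left' (ih (hY.trans hZ))

theorem isDistributable_iff {S R : Finset C} (hSR : Disjoint S R) :
    IsDistributable F t S #R ↔ ∃ home : C → ℕ, (∀ c ∈ S ∪ R, home c < t) ∧
      ∀ i < t, F i {j ∈ S | home j = i} #{q ∈ R | home q = i} := by
  have h := isDistributable_inter_iff (F := F) (t := t) hSR Subset.rfl
  simpa only [union_inter_cancel_left, union_inter_cancel_right, filter_inter] using h

end Distribution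

section Encoding

/-- The function on `U` with values at most `p` encoded by a set `g ⊆ range (#U * p)`: the value at
the `i`-th element of `U` is the number of elements of `g` in the `i`-th block of length `p`. -/
def decodeMap (U : Finset ℕ) (p : ℕ) (g : Finset ℕ) (v : ℕ) : ℕ :=
  #{j ∈ range p | Nat.count (· ∈ U) v * p + j ∈ g}

theorem exists_decodeMap_eq {U : Finset ℕ} {p : ℕ} {f : ℕ → ℕ} (hf : ∀ v ∈ U, f v < p) :
    ∃ g ⊆ range (#U * p), ∀ v ∈ U, decodeMap U p g v = f v := by
  refine ⟨{x ∈ range (#U * p) | x % p < f (Nat.nth (· ∈ U) (x / p))}, filter_subset _ _,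
    fun v hv => ?_⟩
  have hcount : Nat.count (· ∈ U) v < #U := by
    simpa using Nat.count_lt_card (p := (· ∈ U)) U.finite_toSet hv
  have hmem : ∀ j < p, (Nat.count (· ∈ U) v * p + j ∈
      {x ∈ range (#U * p) | x % p < f (Nat.nth (· ∈ U) (x / p))} ↔ j < f v) := fun j hj => by
    have hlt : Nat.count (· ∈ U) v * p + j < #U * p := by nlinarith
    have hdiv : (Nat.count (· ∈ U) v * p + j) / p = Nat.count (· ∈ U) v := by
      rw [Nat.add_comm, Nat.add_mul_div_right _ _ (j.zero_le.trans_lt hj), Nat.div_eq_of_lt hj,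
        Nat.zero_add]
    rw [mem_filter, mem_range, and_iff_right hlt, Nat.mul_add_mod_of_lt hj, hdiv,
      Nat.nth_count hv]
  have hrange : {j ∈ range p | j < f v} = range (f v) := by
    ext j
    have := hf v hv
    simp only [mem_filter, mem_range]
    lia
  rw [decodeMap, filter_congr fun j hj => hmem j (mem_range.1 hj), hrange, card_range]

end Encoding

section Criterion

/-- The class sizes `s + 1` for the colors in `L` and `s` for all others. -/
def target {C : Type*} [DecidableEq C] (s : ℕ) (L : Finset C) (j : C) : ℕ :=
  s + if j ∈ L then 1 else 0

variable {H : SimpleGraph ℕ} {U W : Finset ℕ} {p K s : ℕ} {φ : ℕ → ℕ}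

theorem range_union_Ico (hp : p ≤ K) : range p ∪ Ico p K = range K := by
  rw [range_eq_Ico, range_eq_Ico, Ico_union_Ico_eq_Ico p.zero_le hp]

theorem IsBalancedColoring.isExtension (h : IsBalancedColoring H W (range K) s φ) (hU : U ⊆ W)
    (hp : p ≤ K) {γ : ℕ → ℕ} (hγ : ∀ u ∈ U, γ u = φ u) :
    IsExtension H U (W \ U) γ (range p) (Ico p K)
      (target s {j ∈ range p | #{v ∈ W | φ v = j} = s + 1}) s φ := by
  have hUW : U ∪ W \ U = W := union_sdiff_of_subset hU
  refine ⟨fun u hu => (hγ u hu).symm, fun v hv => ?_, ?_, fun j hj => ?_, fun q hq => ?_,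
    fun q hq => ?_⟩
  · rw [range_union_Ico hp]
    exact h.mem v (mem_sdiff.1 hv).1
  · rw [hUW]
    exact h.proper
  · have hjK : j ∈ range K := range_subset_range.2 hp hj
    have := h.le_card j hjK
    have := h.card_le j hjK
    simp only [hUW, target, mem_filter, hj, true_and]
    split_ifs <;> lia
  · rw [hUW]
    exact h.le_card q (mem_range.2 (mem_Ico.1 hq).2)
  · rw [hUW]
    exact h.card_le q (mem_range.2 (mem_Ico.1 hq).2)

theorem IsExtension.isBalancedColoring {γ : ℕ → ℕ} {L : Finset ℕ}
    (h : IsExtension H U (W \ U) γ (range p) (Ico p K) (target s L) s φ) (hU : U ⊆ W)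
    (hp : p ≤ K) (hγ : ∀ u ∈ U, γ u < p) : IsBalancedColoring H W (range K) s φ := by
  have hUW : U ∪ W \ U = W := union_sdiff_of_subset hU
  have hcard : ∀ j ∈ range K, s ≤ #{v ∈ W | φ v = j} ∧ #{v ∈ W | φ v = j} ≤ s + 1 := fun j hj => by
    rw [← range_union_Ico hp, mem_union] at hj
    rw [← hUW]
    obtain hj | hj := hj
    · rw [h.card_eq j hj, target]
      split_ifs <;> lia
    · exact ⟨h.le_card j hj, h.card_le j hj⟩
  refine ⟨fun v hv => ?_, ?_, fun j hj => (hcard j hj).1, fun j hj => (hcard j hj).2⟩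
  · by_cases hvU : v ∈ U
    · rw [h.eqOn v hvU, mem_range]
      exact (hγ v hvU).trans_le hp
    · rw [← range_union_Ico hp]
      exact h.mem v (mem_sdiff.2 ⟨hv, hvU⟩)
  · rw [← hUW]
    exact h.proper

theorem exists_isBalancedColoring_iff_exists_isExtension (hU : U ⊆ W) (hp : p ≤ K) :
    (∃ φ, IsBalancedColoring H W (range K) s φ ∧ ∀ u ∈ U, φ u < p) ↔
      ∃ g ⊆ range (#U * p), ∃ L ⊆ range p, (∀ u ∈ U, decodeMap U p g u < p) ∧
        ∃ φ, IsExtension H U (W \ U) (decodeMap U p g) (range p) (Ico p K) (target s L) s φ := by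
  constructor
  · rintro ⟨φ, hφ, hlt⟩
    obtain ⟨g, hg, hgφ⟩ := exists_decodeMap_eq hlt
    exact ⟨g, hg, _, filter_subset _ _, fun u hu => hgφ u hu ▸ hlt u hu, φ,
      hφ.isExtension hU hp hgφ⟩
  · rintro ⟨g, -, L, -, hlt, φ, hφ⟩
    exact ⟨φ, hφ.isBalancedColoring hU hp hlt, fun u hu => hφ.eqOn u hu ▸ hlt u hu⟩

/-- `HallCondition` for the part of the co-cluster graph on `X` that is represented by `i`. -/
def PartCondition (H : SimpleGraph ℕ) (U X : Finset ℕ) (γ τ : ℕ → ℕ) (s i : ℕ) (S : Finset ℕ)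
    (r : ℕ) : Prop :=
  HallCondition {v ∈ X | part H X v = i} (avail H U γ {v ∈ X | part H X v = i}) (demand U γ τ) s S r

/-- The condition under which the algorithm extends the coloring `γ` of the modulator with `p` of
the `K` colors, where each color `j < p` is to be used `τ j` times in total. -/
def IsExtendable (H : SimpleGraph ℕ) (n p K s : ℕ) (γ τ : ℕ → ℕ) : Prop :=
  (∀ v ∈ modulator H n, ∀ w ∈ modulator H n, H.Adj v w → γ v ≠ γ w) ∧
    (∀ j ∈ range p, #{u ∈ modulator H n | γ u = j} ≤ τ j) ∧
      IsDistributable (PartCondition H (modulator H n) (range n \ modulator H n) γ τ s) (n + 1)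
        (range p) (K - p)

theorem exists_isExtension_iff_isExtendable {n : ℕ} {γ τ : ℕ → ℕ}
    (hγ : ∀ u ∈ modulator H n, γ u < p) :
    (∃ φ, IsExtension H (modulator H n) (range n \ modulator H n) γ (range p) (Ico p K) τ s φ) ↔
      IsExtendable H n p K s γ τ := by
  have hdisj : Disjoint (range p) (Ico p K) := by
    rw [range_eq_Ico]
    exact Ico_disjoint_Ico_consecutive 0 p K
  have hpart : ∀ v ∈ range n \ modulator H n, ∀ w ∈ range n \ modulator H n, H.Adj v w ↔
      part H (range n \ modulator H n) v ≠ part H (range n \ modulator H n) w :=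
    fun v hv w hw => adj_iff_part_ne (fun a ha b hb c hc => not_isObstruction_of_mem_sdiff ha hb hc)
      hv hw
  have hrange : ∀ v ∈ range n \ modulator H n,
      part H (range n \ modulator H n) v ∈ range (n + 1) := fun v hv =>
    range_subset_range.2 n.le_succ (mem_sdiff.1 (part_mem hv)).1
  rw [exists_isExtension_iff disjoint_sdiff hdisj (fun u hu => mem_range.2 (hγ u hu)) hpart hrange
    nonempty_range_add_one, IsExtendable, ← Nat.card_Ico p K, isDistributable_iff hdisj]
  simp only [mem_range, PartCondition]

end Criterion

section Algorithm

variable {H : SimpleGraph ℕ} {n K s : ℕ}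

/-- `g` encodes a coloring of the modulator with `p` colors that the algorithm extends, when `L` is
the set of those among these colors that are to be used `s + 1` times. -/
def IsCertificate (H : SimpleGraph ℕ) (n p K s : ℕ) (g L : Finset ℕ) : Prop :=
  (∀ u ∈ modulator H n, decodeMap (modulator H n) p g u < p) ∧
    IsExtendable H n p K s (decodeMap (modulator H n) p g) (target s L)

/-- The criterion evaluated by the algorithm. -/
def Accepts (H : SimpleGraph ℕ) (n K s : ℕ) : Prop :=
  ∃ g ⊆ range (#(modulator H n) * min #(modulator H n) K), ∃ L ⊆ range (min #(modulator H n) K),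
    IsCertificate H n (min #(modulator H n) K) K s g L

theorem accepts_iff_exists_isBalancedColoring : Accepts H n K s ↔
    ∃ φ, IsBalancedColoring H (range n) (range K) s φ ∧
      ∀ u ∈ modulator H n, φ u < min #(modulator H n) K := by
  rw [exists_isBalancedColoring_iff_exists_isExtension modulator_subset (min_le_right _ K)]
  exact exists_congr fun g => and_congr_right fun _ => exists_congr fun L =>
    and_congr_right fun _ => and_congr_right fun h => (exists_isExtension_iff_isExtendable h).symm

theorem accepts_iff_equitablyColorable {G : SimpleGraph (Fin n)} {k : ℕ} :
    Accepts (G.map Fin.valEmbedding) n (min k n) (n / min k n) ↔ G.EquitablyColorable k := by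
  rw [accepts_iff_exists_isBalancedColoring,
    exists_isBalancedColoring_iff_equitablyColorable modulator_subset,
    ← equitablyColorable_min_card (k := k), Fintype.card_fin]

theorem card_modulator_le_distToCoCluster (G : SimpleGraph (Fin n)) :
    #(modulator (G.map Fin.valEmbedding) n) ≤ 3 * G.distToCoCluster := by
  obtain ⟨U, hU, hcover⟩ := exists_card_eq_distToCoCluster G
  rw [← hU, ← card_map Fin.valEmbedding]
  refine card_modulator_le fun a b c habc hc => ?_
  obtain ⟨⟨-, a, b, hab, rfl, rfl⟩, hac, hbc⟩ := habc
  lift c to Fin n using hc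
  have h := hcover a b c ⟨hab, fun h => hac ((map_adj_iff a.2 c.2).2 h),
    fun h => hbc ((map_adj_iff b.2 c.2).2 h)⟩
  exact h.imp (mem_map_of_mem _) (Or.imp (mem_map_of_mem _) (mem_map_of_mem _))

end Algorithm

open RAM

/-! ### Running time -/

section Table

variable {F : ℕ → Finset ℕ → ℕ → Prop} {p m c t : ℕ} {S : Finset ℕ}

/-- The position of the entry at `S` and `c ≤ m` in a table of `2 ^ p` rows of length `m + 1`. -/
def tableIndex (m : ℕ) (S : Finset ℕ) (c : ℕ) : ℕ :=
  (∑ i ∈ S, 2 ^ i) * (m + 1) + c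

open Classical in
/-- The truth table of a relation between subsets of `range p` and numbers up to `m`, as the set
of the positions of its true entries. -/
noncomputable def truthTable (p m : ℕ) (A : Finset ℕ → ℕ → Prop) : Finset ℕ :=
  {x ∈ range (2 ^ p * (m + 1)) | ∃ S ⊆ range p, ∃ c < m + 1, tableIndex m S c = x ∧ A S c}

theorem tableIndex_lt (hS : S ⊆ range p) (hc : c < m + 1) :
    tableIndex m S c < 2 ^ p * (m + 1) :=
  calc (∑ i ∈ S, 2 ^ i) * (m + 1) + c < (∑ i ∈ S, 2 ^ i + 1) * (m + 1) := by
        rw [add_one_mul]; lia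
    _ ≤ 2 ^ p * (m + 1) := Nat.mul_le_mul_right _ (sum_two_pow_lt hS)

theorem tableIndex_inj {T : Finset ℕ} {d : ℕ} (hc : c < m + 1) (hd : d < m + 1) :
    tableIndex m S c = tableIndex m T d ↔ S = T ∧ c = d := by
  refine ⟨fun h => ?_, by rintro ⟨rfl, rfl⟩; rfl⟩
  have hdiv := congrArg (· / (m + 1)) h
  have hmod := congrArg (· % (m + 1)) h
  simp only [tableIndex, mul_comm _ (m + 1), Nat.mul_add_div m.succ_pos, Nat.mul_add_mod,
    Nat.div_eq_of_lt hc, Nat.div_eq_of_lt hd, Nat.mod_eq_of_lt hc, Nat.mod_eq_of_lt hd,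
    add_zero] at hdiv hmod
  exact ⟨equivBitIndices.symm.injective hdiv, hmod⟩

theorem tableIndex_mem_truthTable {A : Finset ℕ → ℕ → Prop} (hS : S ⊆ range p) (hc : c < m + 1) :
    tableIndex m S c ∈ truthTable p m A ↔ A S c := by
  simp only [truthTable, mem_filter, mem_range, tableIndex_lt hS hc, true_and]
  constructor
  · rintro ⟨T, -, d, hd, h, hA⟩
    obtain ⟨rfl, rfl⟩ := (tableIndex_inj hd hc).1 h
    exact hA
  · exact fun hA => ⟨S, hS, c, hc, rfl, hA⟩

theorem truthTable_congr {A A' : Finset ℕ → ℕ → Prop}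
    (h : ∀ S ⊆ range p, ∀ c < m + 1, (A S c ↔ A' S c)) : truthTable p m A = truthTable p m A' := by
  classical
  exact filter_congr fun _ _ => exists_congr fun S => and_congr_right fun hS =>
    exists_congr fun c => and_congr_right fun hc => and_congr_right fun _ => h S hS c hc

/-- One round of dynamic programming for `IsDistributable`: it adds a part with the requirement `F`
to those accounted for in the table `X`. -/
noncomputable def distributionStep (p m : ℕ) (X : Finset ℕ) (F : Finset ℕ → ℕ → Prop) :
    Finset ℕ :=
  truthTable p m fun S c =>
    ∃ T ⊆ S, ∃ r < m + 1, r ≤ c ∧ tableIndex m T r ∈ X ∧ F (S \ T) (c - r)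

theorem foldl_distributionStep (t : ℕ) :
    (List.range t).foldl (fun X i => distributionStep p m X (F i))
      (truthTable p m (IsDistributable F 0)) = truthTable p m (IsDistributable F t) := by
  induction t with
  | zero => rfl
  | succ t ih =>
    rw [List.range_succ, List.foldl_concat, ih]
    refine truthTable_congr fun S hS c hc => exists_congr fun T => and_congr_right fun hT =>
      exists_congr fun r => ⟨?_, ?_⟩
    · rintro ⟨hr, hrc, hX, hF⟩
      exact ⟨hrc, (tableIndex_mem_truthTable (hT.trans hS) hr).1 hX, hF⟩
    · rintro ⟨hrc, hD, hF⟩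
      have hr := hrc.trans_lt hc
      exact ⟨hr, hrc, (tableIndex_mem_truthTable (hT.trans hS) hr).2 hD, hF⟩

end Table

section TableComputation

variable {P : ParamProblem} {α : Type} {Γ : Context P α} {p m N : P.Inst → ℕ}

theorem fptComputable_tableIndex {S : α → Finset ℕ} {c : α → ℕ} (hp : IsLoopBound p)
    (hp' : IsLoopBound fun x => 2 ^ p x) (hm : IsLoopBound m) (hS : FPTFinset Γ p S)
    (hc : FPTComputable Γ c) :
    FPTComputable Γ fun a => tableIndex (m (Γ.inst a)) (S a) (c a) := by
  have hsum : FPTComputable Γ fun a => ∑ i ∈ S a, 2 ^ i :=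
    (FPTComputable.sum_mem (f := fun a i => 2 ^ min i (p (Γ.inst a))) hp hS
      (.two_pow_min hp (.last Γ))).congr fun a =>
        sum_congr rfl fun i hi => by rw [min_eq_left (mem_range.1 (hS.subset a hi)).le]
  exact (hsum.mul_of_le hp' ((hm.computable Γ).add (.const Γ 1))
    fun a => (sum_two_pow_lt (hS.subset a)).le).add hc

theorem fptFinset_truthTable {A : α → Finset ℕ → ℕ → Prop} (hp : IsLoopBound p)
    (hp' : IsLoopBound fun x => 2 ^ p x) (hm : IsLoopBound m)
    (hA : FPTDecidable Γ.ext.ext fun a => A a.1.1 (decodeFinset (p (Γ.inst a.1.1)) a.1.2) a.2) :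
    FPTFinset Γ (fun x => 2 ^ p x * (m x + 1))
      fun a => truthTable (p (Γ.inst a)) (m (Γ.inst a)) (A a) := by
  classical
  have hm' : IsLoopBound fun x => m x + 1 := hm.add (.const 1)
  refine FPTFinset.filter (p := fun a x => ∃ S ⊆ range (p (Γ.inst a)), ∃ c < m (Γ.inst a) + 1,
    tableIndex (m (Γ.inst a)) S c = x ∧ A a S c) (hp'.mul hm') <|
    .exists_subset (p := fun (a : α × ℕ) S => ∃ c < m (Γ.inst a.1) + 1,
      tableIndex (m (Γ.inst a.1)) S c = a.2 ∧ A a.1 S c) hp hp' (.range hp _) <|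
    .exists_lt (B := fun x => m x + 1) (p := fun (a : (α × ℕ) × ℕ) c =>
      tableIndex (m (Γ.inst a.1.1)) (decodeFinset (p (Γ.inst a.1.1)) a.2) c = a.1.2 ∧
        A a.1.1 (decodeFinset (p (Γ.inst a.1.1)) a.2) c) hm' <|
    .and (.eq ?_ (.wk (.wk (.last Γ)))) ?_
  · exact fptComputable_tableIndex hp hp' hm (.wk (.last Γ.ext p)) (.last _)
  · exact hA.comp (((FPTMap.id Γ).wk.wk.wk.ext (.wk (.last Γ.ext))).ext (.last _))

theorem fptFinset_distributionStep {X : α → Finset ℕ} {F : α → Finset ℕ → ℕ → Prop}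
    (hp : IsLoopBound p) (hp' : IsLoopBound fun x => 2 ^ p x) (hm : IsLoopBound m)
    (hX : FPTFinset Γ (fun x => 2 ^ p x * (m x + 1)) X)
    (hF : FPTDecidable Γ.ext.ext fun a => F a.1.1 (decodeFinset (p (Γ.inst a.1.1)) a.1.2) a.2) :
    FPTFinset Γ (fun x => 2 ^ p x * (m x + 1))
      fun a => distributionStep (p (Γ.inst a)) (m (Γ.inst a)) (X a) (F a) := by
  have hm' : IsLoopBound fun x => m x + 1 := hm.add (.const 1)
  refine fptFinset_truthTable (A := fun a S c => ∃ T ⊆ S, ∃ r < m (Γ.inst a) + 1, r ≤ c ∧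
    tableIndex (m (Γ.inst a)) T r ∈ X a ∧ F a (S \ T) (c - r)) hp hp' hm <|
    .exists_subset (p := fun (a : (α × ℕ) × ℕ) T => ∃ r < m (Γ.inst a.1.1) + 1, r ≤ a.2 ∧
      tableIndex (m (Γ.inst a.1.1)) T r ∈ X a.1.1 ∧
        F a.1.1 (decodeFinset (p (Γ.inst a.1.1)) a.1.2 \ T) (a.2 - r)) hp hp'
      (.wk (.last Γ p)) <|
    .exists_lt (B := fun x => m x + 1) (p := fun (a : ((α × ℕ) × ℕ) × ℕ) r => r ≤ a.1.2 ∧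
      tableIndex (m (Γ.inst a.1.1.1)) (decodeFinset (p (Γ.inst a.1.1.1)) a.2) r ∈ X a.1.1.1 ∧
        F a.1.1.1 (decodeFinset (p (Γ.inst a.1.1.1)) a.1.1.2 \
          decodeFinset (p (Γ.inst a.1.1.1)) a.2) (a.1.2 - r)) hm' ?_
  have hT : FPTFinset Γ.ext.ext.ext.ext p fun a => decodeFinset (p (Γ.inst a.1.1.1.1)) a.1.2 :=
    .wk (.last Γ.ext.ext p)
  have hc : FPTComputable Γ.ext.ext.ext.ext fun a => a.1.1.2 := .wk (.wk (.last Γ.ext))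
  have hr : FPTComputable Γ.ext.ext.ext.ext fun a => a.2 := .last _
  obtain ⟨C, hC, hdiff⟩ := FPTFinset.sdiff hp (FPTFinset.last Γ p).wk.wk.wk hT
  refine .and (.le hr hc) (.and ?_ ?_)
  · exact hX.wk.wk.wk.wk.mem (hp'.mul hm') (fptComputable_tableIndex hp hp' hm hT hr)
  · refine (hF.comp (((FPTMap.id Γ).wk.wk.wk.wk.ext hC).ext (hc.sub hr))).congr fun a => ?_
    exact iff_of_eq (congrArg (F _ · _) (hdiff a).symm)

theorem fptDecidable_isDistributable {F : α → ℕ → Finset ℕ → ℕ → Prop} (hp : IsLoopBound p)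
    (hp' : IsLoopBound fun x => 2 ^ p x) (hm : IsLoopBound m) (hN : IsLoopBound N)
    (hF : FPTDecidable Γ.ext.ext.ext fun a =>
      F a.1.1.1 a.1.1.2 (decodeFinset (p (Γ.inst a.1.1.1)) a.1.2) a.2) :
    FPTDecidable Γ fun a =>
      IsDistributable (F a) (N (Γ.inst a)) (range (p (Γ.inst a))) (m (Γ.inst a)) := by
  have hzero : FPTFinset Γ (fun x => 2 ^ p x * (m x + 1)) fun a =>
      truthTable (p (Γ.inst a)) (m (Γ.inst a)) (IsDistributable (F a) 0) :=
    fptFinset_truthTable (A := fun a => IsDistributable (F a) 0) hp hp' hm <|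
      .and ((FPTDecidable.eq (.card hp (.wk (.last Γ p))) (.const _ 0)).congr
        fun _ => card_eq_zero) (.eq (.last _) (.const _ 0))
  have hF' : FPTDecidable Γ.ext.ext.ext.ext fun a =>
      F a.1.1.1.1 a.1.1.1.2 (decodeFinset (p (Γ.inst a.1.1.1.1)) a.1.2) a.2 :=
    hF.comp (((FPTMap.id Γ.ext).wk.wk.wk.ext (.wk (.last Γ.ext.ext))).ext (.last _))
  have htable := FPTFinset.foldl (step := fun a X i => distributionStep (p (Γ.inst a))
    (m (Γ.inst a)) X (F a i)) hN hzero
      (fptFinset_distributionStep (F := fun (a : (α × ℕ) × ℕ) => F a.1.1 a.1.2) hp hp' hm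
        (.last _ _) hF')
  refine (htable.mem (hp'.mul (hm.add (.const 1))) (fptComputable_tableIndex hp hp' hm
    (.range hp Γ) (hm.computable Γ))).congr fun a => ?_
  rw [foldl_distributionStep, tableIndex_mem_truthTable subset_rfl (Nat.lt_succ_self _)]

end TableComputation

section Input

variable {α : Type} {Γ : Context equitableColoringByDistToCoCluster α} {F G : α → ℕ}

/-- The graph of an instance, with isolated vertices `n, n + 1, …` added. -/
def graph (x : EqColInstance) : SimpleGraph ℕ :=
  x.G.map Fin.valEmbedding

theorem length_le_inputSize (w : List ℕ) : w.length ≤ inputSize w := by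
  induction w with
  | nil => exact Nat.zero_le _
  | cons a w ih =>
    simp only [inputSize, List.map_cons, List.sum_cons, List.length_cons] at ih ⊢
    lia

theorem inputSize_encode_pos (x : EqColInstance) : 0 < inputSize x.encode :=
  (List.length_pos_of_ne_nil (List.cons_ne_nil _ _)).trans_le (length_le_inputSize _)

theorem isLoopBound_n : IsLoopBound (P := equitableColoringByDistToCoCluster) EqColInstance.n := by
  refine ⟨.of_inputSize fun x => ?_, ((FPTComputable.const _ 0).read).congr fun _ => rfl⟩
  calc x.n ≤ x.n * x.n := Nat.le_mul_self _
    _ ≤ x.encode.length := by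
      simp only [EqColInstance.encode, List.length_cons, List.length_ofFn]
      lia
    _ ≤ inputSize x.encode := length_le_inputSize _

theorem getD_encode_ne_zero_iff (x : EqColInstance) (v w : Fin x.n) :
    x.encode.getD (2 + (x.n * v + w)) 0 ≠ 0 ↔ x.G.Adj v w := by
  rw [add_comm, ← Fin.coe_mkDivMod, EqColInstance.encode, List.getD_cons_succ,
    List.getD_cons_succ, List.getD_eq_getElem _ _ (by simp only [List.length_ofFn, Fin.is_lt]),
    List.getElem_ofFn, Fin.eta, Fin.divNat_mkDivMod, Fin.modNat_mkDivMod]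
  simp

theorem fptDecidable_adj (hF : FPTComputable Γ F) (hG : FPTComputable Γ G) :
    FPTDecidable Γ fun a => (graph (Γ.inst a)).Adj (F a) (G a) := by
  have hn := isLoopBound_n.computable Γ
  have hindex := FPTComputable.add (.const Γ 2)
    ((FPTComputable.mul_of_le isLoopBound_n hn hF fun _ => le_rfl).add hG)
  refine ((FPTDecidable.lt hF hn).and ((FPTDecidable.lt hG hn).and
    (.ne_zero hindex.read))).congr fun a => ?_
  refine ⟨fun ⟨hv, hw, h⟩ => (map_adj_iff hv hw).2 <|
    (getD_encode_ne_zero_iff (Γ.inst a) ⟨_, hv⟩ ⟨_, hw⟩).1 h, ?_⟩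
  rintro ⟨-, v, w, hvw, hv, hw⟩
  exact hv ▸ hw ▸ ⟨v.2, w.2, (getD_encode_ne_zero_iff (Γ.inst a) v w).2 hvw⟩

end Input

section CriterionComputation

variable {P : ParamProblem} {α : Type} {Γ : Context P α} {B p s : P.Inst → ℕ}

theorem fptDecidable_hallCondition {A S : α → Finset ℕ} {N : α → ℕ → Finset ℕ} {d : α → ℕ → ℕ}
    {r : α → ℕ} (hB : IsLoopBound B) (hp : IsLoopBound p) (hp' : IsLoopBound fun x => 2 ^ p x)
    (hs : IsLoopBound s) (hA : FPTFinset Γ B A) (hN : FPTFinset Γ.ext B fun a => N a.1 a.2)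
    (hd : FPTComputable Γ.ext fun a => d a.1 a.2) (hS : FPTFinset Γ p S)
    (hr : FPTComputable Γ r) :
    FPTDecidable Γ fun a => HallCondition (A a) (N a) (d a) (s (Γ.inst a)) (S a) (r a) := by
  have hsum := FPTComputable.sum_mem hp hS hd
  have hmul := FPTComputable.mul_of_le hs (hs.computable Γ) hr fun _ => le_rfl
  have hlift := (FPTMap.id Γ).wk.wk.ext (.last Γ.ext)
  refine (FPTDecidable.and (.forall_subset (p := fun a T => ∑ j ∈ T, d a j ≤ #(T.biUnion (N a)))
    hp hp' hS (.le (.sum_mem (f := fun a => d a.1) hp (.last Γ p) (hd.comp hlift))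
      (.card hB (.biUnion (N := fun a => N a.1) hB hp (.last Γ p) (hN.comp hlift)))))
    (.and (.le (hmul.add hsum) (.card hB hA))
      (.le (.card hB hA) ((hmul.add hr).add hsum)))).congr fun a => ?_
  simp only [mul_comm (s _), ← mul_add_one]
  exact ⟨fun h => ⟨h.1, h.2.1, h.2.2⟩, fun h => ⟨h.hall, h.le_card, h.card_le⟩⟩

theorem fptComputable_decodeMap {U g : α → Finset ℕ} {v : α → ℕ} {B' : P.Inst → ℕ}
    (hB : IsLoopBound B) (hB' : IsLoopBound B') (hp : IsLoopBound p) (hU : FPTFinset Γ B U)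
    (hg : FPTFinset Γ B' g) (hv : FPTComputable Γ v) :
    FPTComputable Γ fun a => decodeMap (U a) (p (Γ.inst a)) (g a) (v a) := by
  have hcount : FPTComputable Γ fun a => Nat.count (· ∈ U a) (v a) := by
    refine (FPTComputable.card hB (.filter_mem (p := fun a i => i < v a) hB hU
      (.lt (.last Γ) hv.wk))).congr fun a => ?_
    rw [Nat.count_eq_card_filter_range]
    congr 1
    ext i
    simp [and_comm]
  refine .card_filter (p := fun a j => Nat.count (· ∈ U a) (v a) * p (Γ.inst a) + j ∈ g a) hp
    (hg.wk.mem hB' (.add (.wk (Γ := Γ) (F := fun a => Nat.count (· ∈ U a) (v a) * p (Γ.inst a)) ?_)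
      (.last Γ)))
  exact (FPTComputable.mul_of_le hp (hp.computable Γ) hcount fun _ => le_rfl).congr
    fun _ => mul_comm _ _

theorem fptComputable_target {L : α → Finset ℕ} {j : α → ℕ} (hp : IsLoopBound p)
    (hs : IsLoopBound s) (hL : FPTFinset Γ p L) (hj : FPTComputable Γ j) :
    FPTComputable Γ fun a => target (s (Γ.inst a)) (L a) (j a) :=
  (hs.computable Γ).add (.ite (hL.mem hp hj) (.const Γ 1) (.const Γ 0))

theorem fptComputable_demand {U : α → Finset ℕ} {γ τ : α → ℕ → ℕ} (hB : IsLoopBound B)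
    (hU : FPTFinset Γ B U) (hγ : FPTComputable Γ.ext fun a => γ a.1 a.2)
    (hτ : FPTComputable Γ.ext fun a => τ a.1 a.2) :
    FPTComputable Γ.ext fun a => demand (U a.1) (γ a.1) (τ a.1) a.2 :=
  hτ.sub (.card hB (.filter_mem (p := fun (a : α × ℕ) u => γ a.1 u = a.2) hB hU.wk
    (.eq (hγ.comp ((FPTMap.id Γ).wk.wk.ext (.last _))) (.wk (.last Γ)))))

end CriterionComputation

section ModulatorComputation

variable {α : Type} {Γ : Context equitableColoringByDistToCoCluster α}
  {p s : EqColInstance → ℕ} {U X : α → Finset ℕ} {γ τ : α → ℕ → ℕ} {i : α → ℕ}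

theorem fptFinset_avail (hU : FPTFinset Γ EqColInstance.n U) (hX : FPTFinset Γ EqColInstance.n X)
    (hγ : FPTComputable Γ.ext fun a => γ a.1 a.2) :
    FPTFinset Γ.ext EqColInstance.n
      fun a => avail (graph (Γ.inst a.1)) (U a.1) (γ a.1) (X a.1) a.2 := by
  classical
  refine .filter_mem (p := fun (a : α × ℕ) v => ∀ u ∈ U a.1, γ a.1 u = a.2 →
    ¬ (graph (Γ.inst a.1)).Adj u v) isLoopBound_n hX.wk (.forall_mem
      (p := fun (a : (α × ℕ) × ℕ) u => γ a.1.1 u = a.1.2 → ¬ (graph (Γ.inst a.1.1)).Adj u a.2)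
        isLoopBound_n hU.wk.wk (.imp (.eq ?_ (.wk (.wk (.last Γ)))) (.not ?_)))
  · exact hγ.comp ((FPTMap.id Γ).wk.wk.wk.ext (.last _))
  · exact fptDecidable_adj (.last _) (.wk (.last _))

theorem fptFinset_filter_part_eq (hX : FPTFinset Γ EqColInstance.n X) (hi : FPTComputable Γ i) :
    FPTFinset Γ EqColInstance.n
      fun a => {v ∈ X a | part (graph (Γ.inst a)) (X a) v = i a} := by
  refine .of_subset isLoopBound_n (fun a => (filter_subset _ _).trans (hX.subset a)) ?_
  refine ((hX.wk.mem isLoopBound_n (.last Γ)).and (((hX.wk.mem isLoopBound_n hi.wk).and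
    (fptDecidable_adj (.last Γ) hi.wk).not).and (.forall_mem (p := fun (a : α × ℕ) w => w < i a.1 →
      (graph (Γ.inst a.1)).Adj a.2 w) isLoopBound_n hX.wk (.imp (.lt (.last _) hi.wk.wk)
        (fptDecidable_adj (.wk (.last Γ)) (.last _)))))).congr fun a => ?_
  rw [mem_filter]
  refine and_congr_right fun ha => ?_
  rw [part_eq_iff ha]
  exact and_congr_right fun _ => forall_congr' fun _ => imp.swap

theorem fptDecidable_partCondition {S : α → Finset ℕ} {r : α → ℕ}
    (hp : IsLoopBound (P := equitableColoringByDistToCoCluster) p)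
    (hp' : IsLoopBound (P := equitableColoringByDistToCoCluster) fun x => 2 ^ p x)
    (hs : IsLoopBound (P := equitableColoringByDistToCoCluster) s)
    (hU : FPTFinset Γ EqColInstance.n U) (hX : FPTFinset Γ EqColInstance.n X)
    (hγ : FPTComputable Γ.ext fun a => γ a.1 a.2) (hτ : FPTComputable Γ.ext fun a => τ a.1 a.2)
    (hi : FPTComputable Γ i) (hS : FPTFinset Γ p S) (hr : FPTComputable Γ r) :
    FPTDecidable Γ fun a => PartCondition (graph (Γ.inst a)) (U a) (X a) (γ a) (τ a)
      (s (Γ.inst a)) (i a) (S a) (r a) :=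
  have hA := fptFinset_filter_part_eq hX hi
  fptDecidable_hallCondition isLoopBound_n hp hp' hs hA (fptFinset_avail hU hA hγ)
    (fptComputable_demand isLoopBound_n hU hγ hτ) hS hr

theorem fptFinset_obstructionSet {a b c : α → ℕ} (ha : FPTComputable Γ a)
    (hb : FPTComputable Γ b) (hc : FPTComputable Γ c) : FPTFinset Γ EqColInstance.n
      fun x => obstructionSet (graph (Γ.inst x)) (Γ.inst x).n (a x) (b x) (c x) := by
  classical
  exact .filter (p := fun x v => IsObstruction (graph (Γ.inst x)) (a x) (b x) (c x) ∧
    (v = a x ∨ v = b x ∨ v = c x)) isLoopBound_n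
      (.and (.wk (.and (fptDecidable_adj ha hb)
        (.and (.not (fptDecidable_adj ha hc)) (.not (fptDecidable_adj hb hc)))))
        (.or (.eq (.last Γ) ha.wk) (.or (.eq (.last Γ) hb.wk) (.eq (.last Γ) hc.wk))))

theorem fptFinset_modulator :
    FPTFinset Γ EqColInstance.n fun a => modulator (graph (Γ.inst a)) (Γ.inst a).n := by
  simp only [modulator, greedyHittingSet, obstructions, List.foldl_flatMap, List.foldl_map]
  let collect (x : EqColInstance) (a b : ℕ) (U : Finset ℕ) (c : ℕ) : Finset ℕ :=
    if Disjoint U (obstructionSet (graph x) x.n a b c) then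
      U ∪ obstructionSet (graph x) x.n a b c else U
  have hset := fptFinset_obstructionSet (Γ := Γ.ext.ext.ext.ext.ext.ext)
    (.wk (.wk (.wk (.wk (.wk (.last Γ)))))) (.wk (.wk (.wk (.last Γ.ext.ext))))
    (.wk (.last Γ.ext.ext.ext.ext))
  have hlast := FPTFinset.last Γ.ext.ext.ext.ext.ext EqColInstance.n
  refine .foldl (step := fun x U a => (List.range (Γ.inst x).n).foldl (fun U b =>
    (List.range (Γ.inst x).n).foldl (collect (Γ.inst x) a b) U) U) isLoopBound_n (.empty Γ _) <|
    .foldl (step := fun (x : (α × ℕ) × ℕ) U b => (List.range (Γ.inst x.1.1).n).foldl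
      (collect (Γ.inst x.1.1) x.1.2 b) U) isLoopBound_n (.last Γ.ext _) <|
    .foldl (step := fun (x : (((α × ℕ) × ℕ) × ℕ) × ℕ) U c => collect (Γ.inst x.1.1.1.1)
      x.1.1.1.2 x.1.2 U c) isLoopBound_n (.last Γ.ext.ext.ext _) ?_
  exact .ite (hlast.disjoint isLoopBound_n hset) (.union isLoopBound_n hlast hset) hlast

end ModulatorComputation

section Algorithm

/-- The number of colors to which the algorithm reduces the instance: surplus colors, each of which
is used at most once, are discarded. -/
def numColors (x : EqColInstance) : ℕ :=
  min x.k x.n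

/-- The size of the smaller color classes. -/
def classSize (x : EqColInstance) : ℕ :=
  x.n / numColors x

/-- The number of vertices that the algorithm deletes. -/
noncomputable def modulatorCard (x : EqColInstance) : ℕ :=
  #(modulator (graph x) x.n)

/-- The number of colors that suffice for the deleted vertices. -/
noncomputable def numModulatorColors (x : EqColInstance) : ℕ :=
  min (modulatorCard x) (numColors x)

theorem isLoopBound_numColors : IsLoopBound (P := equitableColoringByDistToCoCluster) numColors :=
  isLoopBound_n.of_le (.min ((FPTComputable.const _ 1).read.congr fun _ => rfl)
    isLoopBound_n.computable_base) fun _ => min_le_right _ _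

theorem isLoopBound_classSize : IsLoopBound (P := equitableColoringByDistToCoCluster) classSize :=
  isLoopBound_n.of_le (.div_of_le isLoopBound_n isLoopBound_n.computable_base
    isLoopBound_numColors.computable_base fun _ => le_rfl) fun _ => Nat.div_le_self _ _

theorem isLoopBound_modulatorCard :
    IsLoopBound (P := equitableColoringByDistToCoCluster) modulatorCard :=
  isLoopBound_n.of_le (.card isLoopBound_n fptFinset_modulator) fun _ =>
    (card_le_card modulator_subset).trans_eq (card_range _)

theorem isLoopBound_numModulatorColors :
    IsLoopBound (P := equitableColoringByDistToCoCluster) numModulatorColors :=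
  isLoopBound_modulatorCard.of_le (.min isLoopBound_modulatorCard.computable_base
    isLoopBound_numColors.computable_base) fun _ => min_le_left _ _

theorem computable_three_mul : Computable fun d : ℕ => 3 * d :=
  (Primrec.nat_mul.comp (.const 3) .id).to_comp

theorem numModulatorColors_le (x : EqColInstance) :
    numModulatorColors x ≤ 3 * x.G.distToCoCluster :=
  (min_le_left _ _).trans (card_modulator_le_distToCoCluster x.G)

theorem isLoopBound_two_pow_numModulatorColors :
    IsLoopBound (P := equitableColoringByDistToCoCluster) fun x => 2 ^ numModulatorColors x :=
  isLoopBound_numModulatorColors.two_pow computable_three_mul numModulatorColors_le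

theorem isLoopBound_two_pow_modulatorCard_mul :
    IsLoopBound (P := equitableColoringByDistToCoCluster)
      fun x => 2 ^ (modulatorCard x * numModulatorColors x) :=
  (isLoopBound_modulatorCard.mul isLoopBound_numModulatorColors).two_pow
    (Primrec.nat_mul.to_comp.comp computable_three_mul computable_three_mul) fun x =>
      Nat.mul_le_mul (card_modulator_le_distToCoCluster x.G) (numModulatorColors_le x)

variable {α : Type} {Γ : Context equitableColoringByDistToCoCluster α}

theorem fptDecidable_isExtendable {γ τ : α → ℕ → ℕ}
    (hγ : FPTComputable Γ.ext fun a => γ a.1 a.2) (hτ : FPTComputable Γ.ext fun a => τ a.1 a.2) :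
    FPTDecidable Γ fun a => IsExtendable (graph (Γ.inst a)) (Γ.inst a).n
      (numModulatorColors (Γ.inst a)) (numColors (Γ.inst a)) (classSize (Γ.inst a)) (γ a)
        (τ a) := by
  have hn := isLoopBound_n
  have hp := isLoopBound_numModulatorColors
  have hp' := isLoopBound_two_pow_numModulatorColors
  have hU := fptFinset_modulator (Γ := Γ)
  have hγ' := hγ.comp ((FPTMap.id Γ).wk.wk.ext (.last Γ.ext))
  refine .and ?proper (.and ?sizes ?distributable)
  case proper =>
    exact .forall_mem (p := fun a v => ∀ w ∈ modulator (graph (Γ.inst a)) (Γ.inst a).n,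
      (graph (Γ.inst a)).Adj v w → γ a v ≠ γ a w) hn hU <| .forall_mem (p := fun (a : α × ℕ) w =>
        (graph (Γ.inst a.1)).Adj a.2 w → γ a.1 a.2 ≠ γ a.1 w) hn hU.wk <|
          .imp (fptDecidable_adj (.wk (.last Γ)) (.last _)) (.not (.eq hγ.wk hγ'))
  case sizes =>
    exact .forall_mem (p := fun a j => #{u ∈ modulator (graph (Γ.inst a)) (Γ.inst a).n |
      γ a u = j} ≤ τ a j) hp (.range hp Γ) <| .le (.card hn <| .filter_mem
        (p := fun (a : α × ℕ) u => γ a.1 u = a.2) hn hU.wk (.eq hγ' (.wk (.last Γ)))) hτ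
  case distributable =>
    have hm := isLoopBound_numColors.of_le (isLoopBound_numColors.computable_base.sub
      hp.computable_base) fun _ => Nat.sub_le _ _
    have hW := (FPTFinset.range hn Γ).sdiff hn hU
    have hlift := (FPTMap.id Γ).wk.wk.wk.wk.ext (.last Γ.ext.ext.ext)
    exact fptDecidable_isDistributable hp hp' hm (hn.add (.const 1)) <|
      fptDecidable_partCondition (γ := fun (a : ((α × ℕ) × ℕ) × ℕ) => γ a.1.1.1)
        (τ := fun (a : ((α × ℕ) × ℕ) × ℕ) => τ a.1.1.1) hp hp' isLoopBound_classSize hU.wk.wk.wk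
          hW.wk.wk.wk (hγ.comp hlift) (hτ.comp hlift) (.wk (.wk (.last Γ))) (.wk (.last Γ.ext _))
            (.last _)

theorem fptDecidable_isCertificate {g L : α → Finset ℕ}
    (hg : FPTFinset Γ (fun x => modulatorCard x * numModulatorColors x) g)
    (hL : FPTFinset Γ numModulatorColors L) :
    FPTDecidable Γ fun a => IsCertificate (graph (Γ.inst a)) (Γ.inst a).n
      (numModulatorColors (Γ.inst a)) (numColors (Γ.inst a)) (classSize (Γ.inst a)) (g a)
        (L a) := by
  have hn := isLoopBound_n
  have hp := isLoopBound_numModulatorColors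
  have hγ := fptComputable_decodeMap hn (isLoopBound_modulatorCard.mul hp) hp
    (fptFinset_modulator (Γ := Γ.ext)) hg.wk (.last Γ)
  exact .and (.forall_mem (p := fun a u => decodeMap (modulator (graph (Γ.inst a)) (Γ.inst a).n)
    (numModulatorColors (Γ.inst a)) (g a) u < numModulatorColors (Γ.inst a)) hn fptFinset_modulator
      (.lt hγ (hp.computable _))) <|
    fptDecidable_isExtendable hγ (fptComputable_target hp isLoopBound_classSize hL.wk (.last Γ))

theorem fptDecidable_accepts :
    FPTDecidable (Context.base equitableColoringByDistToCoCluster)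
      fun x => Accepts (graph x) x.n (numColors x) (classSize x) := by
  have hp := isLoopBound_numModulatorColors
  have hgp := isLoopBound_modulatorCard.mul hp
  refine .exists_subset (p := fun x g => ∃ L ⊆ range (numModulatorColors x), IsCertificate (graph x)
    x.n (numModulatorColors x) (numColors x) (classSize x) g L) hgp
      isLoopBound_two_pow_modulatorCard_mul (.range hgp _) <|
    .exists_subset (p := fun (a : EqColInstance × ℕ) L => IsCertificate (graph a.1) a.1.n
      (numModulatorColors a.1) (numColors a.1) (classSize a.1)
        (decodeFinset (modulatorCard a.1 * numModulatorColors a.1) a.2) L) hp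
          isLoopBound_two_pow_numModulatorColors (.range hp _) <|
    fptDecidable_isCertificate (.wk (.last _ _)) (.last _ _)

end Algorithm

end EquitableColoring

theorem mainTheorem2 : equitableColoringByDistToCoCluster.IsFPT :=
  RAM.isFPT_of_fptDecidable EquitableColoring.inputSize_encode_pos <|
    EquitableColoring.fptDecidable_accepts.congr fun _ =>
      EquitableColoring.accepts_iff_equitablyColorable
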